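/- Let $D\ge 0$ and $K=k_{IJ}\ge 0$ be fixed integers, and let $\Omega_\theta\subseteq\mathbb R^D$ be a fixed open convex set. Let $g_0,g_1,g_2,\dots$ be random functions with values in $\mathbb R^D$, and for $N\ge 1$ and $w\in\mathbb R^N$ put $$G_N(\theta,w)=\frac1N\Big(g_0(\theta)+\sum_{n=1}^N w_n g_n(\theta)\Big).$$ A superscript $(k)$ denotes the array of all $k$-th order partial derivatives in $\theta$, $\|\cdot\|_2$ is the Euclidean norm of the vectorized array, $1_N$ is the all-ones vector, and $w_{(-n)}\in\mathbb R^N$ is the leave-one-out weight vector with $n$-th entry $0$ and all other entries $1$. For $\eta>0$ let $\Omega_{w,\eta}=\{\tilde w:\ \|\tilde w-((1-t)1_N+tw)\|_2<\eta \text{ for some } t\in[0,1]\}$. Let $\hat\theta_N(\cdot)$ be a (data-dependent) function from $\mathbb R^N$ to $\mathbb R^D$. Assume: (IID) For each $0\le k\le K+1$ the random functions $g_n^{(k)}$ on $\Omega_\theta$, $n\ge1$, are independent and identically distributed, and $\mathbb E\|g_n^{(k)}(\theta)\|_2^2<\infty$ for every $\theta\in\Omega_\theta$. (Deterministic assumptions,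 uniformly in $N$) There are constants $\varepsilon>0$, $C_{op}$, $M_1,\dots,M_{K+1}$, not depending on $N$, such that almost surely, for all $N$ (it suffices: for all $N\ge N_0$, where $N_0$ is a finite, possibly random, index): 1. for every $1\le n\le N$ there is $\eta>0$ such that $G_N(\hat\theta_N(\tilde w),\tilde w)=0$ for all $\tilde w\in\Omega_{w_{(-n)},\eta}$, and $\Omega_\theta$ contains every point at distance less than $\varepsilon$ from the convex hull of $\{\hat\theta_N(\tilde w):\tilde w\in\Omega_{w_{(-n)},\eta}\}$; 2. $g_0,\dots,g_N$ are $K+1$ times continuously differentiable on $\Omega_\theta$; 3. for all $\theta\in\Omega_\theta$ the matrix $H=G_N^{(1)}(\theta,1_N)$ is strongly positive definite with constant $C_{op}$: it is invertible, $\|H^{-1}\|_{op}\le C_{op}$ and $\|v\|_2^2\le C_{op}\,v^{T}Hv$ for all $v\in\mathbb R^D$ (for symmetric positive definite $H$ the two bounds are equivalent); 4. $\sup_{\theta\in\Omega_\theta}\|G_N^{(k)}(\theta,1_N)\|_2\le M_k$ for all $1\le k\le K+1$. Then, with probability tending to one as $N\to\infty$, $\hat\theta_N$ is $K$ times continuously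 differentiable at $1_N$, so that the $K$-th order infinitesimal jackknife $$\hat\theta^{IJ}_{N,K}(w)=\hat\theta_N(1_N)+\sum_{k=1}^{K}\frac1{k!}\,\frac{d^k}{dt^k}\Big|_{t=0}\hat\theta_N\big(1_N+t(w-1_N)\big)$$ is defined, and $$\max_{1\le n\le N}\big\|\hat\theta^{IJ}_{N,K}(w_{(-n)})-\hat\theta_N(w_{(-n)})\big\|_2=O_p\big(N^{-\frac12(K+1)}\big)\qquad(N\to\infty).$$ -/

import Mathlib

open MeasureTheory ProbabilityTheory Filter Topology

namespace HOIJ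

/-- The parameter space `ℝ^D` with its Euclidean norm. -/
abbrev Param (D : ℕ) : Type := EuclideanSpace ℝ (Fin D)

/-- The space `ℝ^N` of weight vectors with its Euclidean norm. -/
abbrev Weight (N : ℕ) : Type := EuclideanSpace ℝ (Fin N)

/-- A `D^(k+1)`-dimensional array: `a idx d` is the entry with differentiation indices
`idx = (d_1, …, d_k)` and output coordinate `d`. -/
abbrev DerivArray (D k : ℕ) : Type := (Fin k → Fin D) → Fin D → ℝ

/-- The array of all `k`-th order partial derivatives of `f` at `θ`. -/
noncomputable def derivArray {D : ℕ} (k : ℕ) (f : Param D → Param D) (θ : Param D) :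
    DerivArray D k :=
  fun idx d => (iteratedFDeriv ℝ k f θ (fun j => EuclideanSpace.single (idx j) (1 : ℝ))) d

/-- The `L₂` norm of the vectorized array. -/
noncomputable def arrayNorm {D k : ℕ} (a : DerivArray D k) : ℝ :=
  Real.sqrt (∑ idx, ∑ d, (a idx d) ^ 2)

/-- `G(θ, w) = (1/N) (g_0(θ) + ∑_{n=1}^N w_n g_n(θ))`. The `n`-th datum, `1 ≤ n ≤ N`, has the
coordinate `n - 1` in `Fin N`. -/
noncomputable def estEq {D : ℕ} (N : ℕ) (g : ℕ → Param D → Param D) (θ : Param D)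
    (w : Weight N) : Param D :=
  (1 / (N : ℝ)) • (g 0 θ + ∑ i : Fin N, w i • g ((i : ℕ) + 1) θ)

/-- The all-ones weight vector `1_N`. -/
noncomputable def ones (N : ℕ) : Weight N := WithLp.toLp 2 (fun _ => (1 : ℝ))

/-- The leave-one-out weight vector: `0` in the coordinate `n` and `1` elsewhere. -/
noncomputable def looWeight {N : ℕ} (n : Fin N) : Weight N :=
  WithLp.toLp 2 (fun i => if i = n then (0 : ℝ) else 1)

/-- The open `η`-neighbourhood `Ω_w` of the segment from `1_N` to `w`. -/
def weightDomain {N : ℕ} (w : Weight N) (η : ℝ) : Set (Weight N) :=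
  {w' | ∃ t ∈ Set.Icc (0 : ℝ) 1, ‖w' - ((1 - t) • ones N + t • w)‖ < η}

/-- The `k`-th order directional derivative of `θhat` at `1_N` in the direction `w - 1_N`. -/
noncomputable def dirDeriv {D N : ℕ} (k : ℕ) (θhat : Weight N → Param D) (w : Weight N) :
    Param D :=
  iteratedFDeriv ℝ k θhat (ones N) (fun _ => w - ones N)

/-- The order `K` higher-order infinitesimal jackknife: the Taylor polynomial of `θhat` of
order `K` centered at `1_N` and evaluated at `w`. -/
noncomputable def hoij {D N : ℕ} (K : ℕ) (θhat : Weight N → Param D) (w : Weight N) : Param D :=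
  θhat (ones N) + ∑ k ∈ Finset.Icc 1 K, (1 / (k.factorial : ℝ)) • dirDeriv k θhat w

/-- The error of the order `K` infinitesimal jackknife at `w`. -/
noncomputable def hoijError {D N : ℕ} (K : ℕ) (θhat : Weight N → Param D) (w : Weight N) : ℝ :=
  ‖hoij K θhat w - θhat w‖

/-- `A` is strongly positive definite with constant `C`: it is invertible with
`‖A⁻¹‖_op ≤ C`, and `⟨v, A v⟩ ≥ ‖v‖² / C` (written without division). For symmetric positive
definite `A` the two bounds are equivalent; `A` need not be symmetric here. -/
def StronglyPosDef {D : ℕ} (C : ℝ) (A : Param D →L[ℝ] Param D) : Prop :=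
  A.IsInvertible ∧ ‖A.inverse‖ ≤ C ∧ ∀ v : Param D, ‖v‖ ^ 2 ≤ C * inner ℝ v (A v)

/-- The deterministic assumptions for sample size `N` and all leave-one-out weights.
`Ωθ` is the parameter domain, `ε` the enlargement constant, `C` the bound on the inverse
Hessian and `M k` the bound on the `k`-th derivative array. -/
structure LooAssumptions {D : ℕ} (K N : ℕ) (Ωθ : Set (Param D)) (ε C : ℝ) (M : ℕ → ℝ)
    (g : ℕ → Param D → Param D) (θhat : Weight N → Param D) : Prop where
  /-- For every leave-one-out weight `w`, on some neighbourhood `Ω_w` of the segment from `1_N`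
  to `w`, `θhat` solves the estimating equation and `Ωθ` contains the `ε`-enlargement of the
  convex hull of these solutions. -/
  solution : ∀ n : Fin N, ∃ η > 0,
    (∀ w' ∈ weightDomain (looWeight n) η, estEq N g (θhat w') w' = 0) ∧
    Metric.thickening ε (convexHull ℝ (θhat '' weightDomain (looWeight n) η)) ⊆ Ωθ
  /-- `g_0, …, g_N` are `K + 1` times continuously differentiable on `Ωθ`. -/
  diffable : ∀ n ≤ N, ContDiffOn ℝ ((K + 1 : ℕ) : WithTop ℕ∞) (g n) Ωθ
  /-- The Hessian at `1_N` is strongly positive definite on `Ωθ`. -/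
  convexity : ∀ θ ∈ Ωθ, StronglyPosDef C (fderiv ℝ (fun θ' => estEq N g θ' (ones N)) θ)
  /-- The derivative arrays of orders `1, …, K + 1` at `1_N` are bounded on `Ωθ`. -/
  bounded : ∀ k, 1 ≤ k → k ≤ K + 1 → ∀ θ ∈ Ωθ,
    arrayNorm (derivArray k (fun θ' => estEq N g θ' (ones N)) θ) ≤ M k

/-- The random functions `g_n^{(k)}` on `Ωθ`, `n ≥ 1`, are independent and identically
distributed for every `0 ≤ k ≤ K + 1`, with finite second moment at each point of `Ωθ`. A random
function is a random element of the product space of all arrays indexed by `Ωθ`. -/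
structure IIDDerivs {Ω : Type*} [MeasurableSpace Ω] (μ : Measure Ω) {D : ℕ} (K : ℕ)
    (Ωθ : Set (Param D)) (g : ℕ → Ω → Param D → Param D) : Prop where
  indep : ∀ k ≤ K + 1,
    iIndepFun (fun (n : ℕ) (ω : Ω) (θ : Ωθ) => derivArray k (g (n + 1) ω) (θ : Param D)) μ
  identDistrib : ∀ k ≤ K + 1, ∀ n : ℕ,
    IdentDistrib (fun (ω : Ω) (θ : Ωθ) => derivArray k (g (n + 1) ω) (θ : Param D))
      (fun (ω : Ω) (θ : Ωθ) => derivArray k (g 1 ω) (θ : Param D)) μ μ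
  secondMoment : ∀ k ≤ K + 1, ∀ n : ℕ, ∀ θ ∈ Ωθ,
    Integrable (fun ω => arrayNorm (derivArray k (g (n + 1) ω) θ) ^ 2) μ

/-- `X_N = O_p(r_N)` as `N → ∞`. -/
def IsBigOInProb {Ω : Type*} [MeasurableSpace Ω] (μ : Measure Ω) (X : ℕ → Ω → ℝ)
    (r : ℕ → ℝ) : Prop :=
  ∀ p : ENNReal, 0 < p → ∃ B : ℝ, ∀ᶠ N in atTop, μ {ω | B * r N < |X N ω|} ≤ p

end HOIJ

/-!
Write `F = G_N(·, 1_N)` and `u = g_n / N`. On the segment `1_N - t e_n` from `1_N` to the `n`-th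
leave-one-out weight, the solution `x t` satisfies `F (x t) = t • u (x t)`, and the jackknife of
order `K` is the Taylor polynomial of `x` at `0`, evaluated at `1`. Put `δ = N ^ (-1/2)`. It
suffices to show that the derivative of `x` of order `K + 1` is `O(δ ^ (K + 1))`, uniformly in `n`
and `t ∈ [0, 1]`.

*Deterministic part.* Differentiating the equation once gives the linear equation
`(F' - t u')(x) x' = u(x)`. If the derivatives of `F` are bounded, those of `u` are `O(δ)` up to
the order `K`, and `F' - t u'` is bounded below, then induction on `j` shows that the `j`-th
derivative of `x` is `O(δ ^ j)` for `j ≤ K + 1`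
(`HOIJ.exists_norm_iteratedFDeriv_curve_le`). The derivative of `u` of order `K + 1` only has to
be bounded, because it is always multiplied by `K + 1` first derivatives of `x`. The smoothness of
the solution comes from the implicit function theorem; the continuity this requires, and the
proximity of the solution to a reference point, come from strong monotonicity, by which `F` is
expansive: `‖a - b‖ ≤ C ‖F a - F b‖`. The outcome is `HOIJ.exists_hoijError_le`.

*Stochastic part.* Second moments are available only at single points of the parameter domain, so
that the `O(δ)` bounds on `u` have to be transported from a fixed point. The reference point is a
root `θ₀` of the mean `E g_1`, which exists because every limit point of the solutions is one
(`HOIJ.IIDDerivs.exists_root`). By Chebyshev's inequality `F θ₀ = O_p(δ)`, so that the solutions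
are within `O_p(δ)` of `θ₀`; by Markov's inequality the derivatives of all `g_n / N` at `θ₀` are
`O_p(δ)`. To move from `θ₀` to the solutions, and to keep `F' - t u'` bounded below, it remains to
bound `max_n sup_θ ‖g_n^{(k)}(θ)‖` by a small multiple of `N`. The assumptions contain no moment of
the supremum, but they force one: `g_n` is the difference of `n G_n` and `(n - 1) G_{n-1}`, whose
derivatives are `O(n)` uniformly in `θ`, so that the suprema of the independent `g_n^{(k)}` almost
surely grow at most linearly, and by the second Borel–Cantelli lemma they have a finite first
moment, whence their maximum is `o_p(N)`
(`HOIJ.tendsto_measure_exists_lt_of_ae_eventually_le`).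
-/

namespace HOIJ

/-! ### Derivatives of products, compositions and solutions of linear equations -/

section Jets

variable {E F G : Type*} [NormedAddCommGroup E] [NormedSpace ℝ E]
  [NormedAddCommGroup F] [NormedSpace ℝ F] [NormedAddCommGroup G] [NormedSpace ℝ G]

/-- Leibniz bound for a bilinear product of functions that are smooth at a single point. -/
theorem norm_iteratedFDeriv_clm_apply_at {f : E → F →L[ℝ] G} {g : E → F} {x : E} {n : ℕ}
    (hf : ContDiffAt ℝ n f x) (hg : ContDiffAt ℝ n g x) :
    ‖iteratedFDeriv ℝ n (fun y => f y (g y)) x‖ ≤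
      ∑ i ∈ Finset.range (n + 1), (n.choose i : ℝ) * ‖iteratedFDeriv ℝ i f x‖ *
        ‖iteratedFDeriv ℝ (n - i) g x‖ := by
  obtain ⟨U, hU, hxU, hfU⟩ := hf.contDiffOn' le_rfl (by simp)
  obtain ⟨V, hV, hxV, hgV⟩ := hg.contDiffOn' le_rfl (by simp)
  have ho : IsOpen (U ∩ V) := hU.inter hV
  have hx : x ∈ U ∩ V := ⟨hxU, hxV⟩
  have h := norm_iteratedFDerivWithin_clm_apply (s := U ∩ V) (x := x) (n := n)
    (hfU.mono fun y hy => ⟨Set.mem_insert_of_mem _ (Set.mem_univ _), hy.1⟩)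
    (hgV.mono fun y hy => ⟨Set.mem_insert_of_mem _ (Set.mem_univ _), hy.2⟩)
    ho.uniqueDiffOn hx le_rfl
  simpa only [iteratedFDerivWithin_of_isOpen _ ho hx] using h

/-- Leibniz bound for a scalar multiple of functions that are smooth at a single point. -/
theorem norm_iteratedFDeriv_smul_at {f : E → ℝ} {g : E → F} {x : E} {n : ℕ}
    (hf : ContDiffAt ℝ n f x) (hg : ContDiffAt ℝ n g x) :
    ‖iteratedFDeriv ℝ n (fun y => f y • g y) x‖ ≤
      ∑ i ∈ Finset.range (n + 1), (n.choose i : ℝ) * ‖iteratedFDeriv ℝ i f x‖ *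
        ‖iteratedFDeriv ℝ (n - i) g x‖ := by
  obtain ⟨U, hU, hxU, hfU⟩ := hf.contDiffOn' le_rfl (by simp)
  obtain ⟨V, hV, hxV, hgV⟩ := hg.contDiffOn' le_rfl (by simp)
  have ho : IsOpen (U ∩ V) := hU.inter hV
  have hx : x ∈ U ∩ V := ⟨hxU, hxV⟩
  have h := norm_iteratedFDerivWithin_smul_le (s := U ∩ V) (x := x) (n := n)
    (hfU.mono fun y hy => ⟨Set.mem_insert_of_mem _ (Set.mem_univ _), hy.1⟩)
    (hgV.mono fun y hy => ⟨Set.mem_insert_of_mem _ (Set.mem_univ _), hy.2⟩)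
    ho.uniqueDiffOn hx le_rfl
  simpa only [iteratedFDerivWithin_of_isOpen _ ho hx] using h

/-- Faà di Bruno bound for functions that are smooth at a single point. -/
theorem norm_iteratedFDeriv_comp_at {g : F → G} {f : E → F} {x : E} {n : ℕ}
    (hg : ContDiffAt ℝ n g (f x)) (hf : ContDiffAt ℝ n f x) {C D : ℝ}
    (hC : ∀ i ≤ n, ‖iteratedFDeriv ℝ i g (f x)‖ ≤ C)
    (hD : ∀ i, 1 ≤ i → i ≤ n → ‖iteratedFDeriv ℝ i f x‖ ≤ D ^ i) :
    ‖iteratedFDeriv ℝ n (fun y => g (f y)) x‖ ≤ n.factorial * C * D ^ n := by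
  obtain ⟨V, hV, hxV, hgV⟩ := hg.contDiffOn' le_rfl (by simp)
  obtain ⟨U, hU, hxU, hfU⟩ := hf.contDiffOn' le_rfl (by simp)
  obtain ⟨W, hWs, hW, hxW⟩ := mem_nhds_iff.1
    (hf.continuousAt.preimage_mem_nhds (hV.mem_nhds hxV))
  have ho : IsOpen (U ∩ W) := hU.inter hW
  have hx : x ∈ U ∩ W := ⟨hxU, hxW⟩
  have h := norm_iteratedFDerivWithin_comp_le (s := U ∩ W) (t := V) (x := x) (n := n)
    (g := g) (f := f) (C := C) (D := D)
    (hgV.mono fun y hy => ⟨Set.mem_insert_of_mem _ (Set.mem_univ _), hy⟩)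
    (hfU.mono fun y hy => ⟨Set.mem_insert_of_mem _ (Set.mem_univ _), hy.1⟩) le_rfl
    hV.uniqueDiffOn ho.uniqueDiffOn (fun y hy => hWs hy.2) hx
    (fun i hi => by rw [iteratedFDerivWithin_of_isOpen _ hV hxV]; exact hC i hi)
    (fun i h1 hi => by rw [iteratedFDerivWithin_of_isOpen _ ho hx]; exact hD i h1 hi)
  simpa only [iteratedFDerivWithin_of_isOpen _ ho hx, Function.comp_def] using h

theorem norm_iteratedFDeriv_deriv (j : ℕ) (f : ℝ → E) (t : ℝ) :
    ‖iteratedFDeriv ℝ j (deriv f) t‖ = ‖iteratedFDeriv ℝ (j + 1) f t‖ := by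
  rw [norm_iteratedFDeriv_eq_norm_iteratedDeriv, norm_iteratedFDeriv_eq_norm_iteratedDeriv,
    iteratedDeriv_succ']

theorem contDiffAt_deriv {n : ℕ} {f : ℝ → E} {t : ℝ}
    (hf : ContDiffAt ℝ ((n + 1 : ℕ) : WithTop ℕ∞) f t) : ContDiffAt ℝ n (deriv f) t := by
  have h : ContDiffAt ℝ n (fderiv ℝ f) t := hf.fderiv_right (by exact_mod_cast le_rfl)
  exact h.clm_apply contDiffAt_const

theorem norm_iteratedFDeriv_id_smul_le {f : ℝ → E} {t : ℝ} {j : ℕ}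
    (hf : ContDiffAt ℝ ((j + 1 : ℕ) : WithTop ℕ∞) f t) :
    ‖iteratedFDeriv ℝ (j + 1) (fun s => s • f s) t‖ ≤
      |t| * ‖iteratedFDeriv ℝ (j + 1) f t‖ + (j + 1) * ‖iteratedFDeriv ℝ j f t‖ := by
  have h := norm_iteratedFDeriv_smul_at (f := fun s : ℝ => s) contDiffAt_id hf
  refine h.trans (le_of_eq ?_)
  have h1 : ‖iteratedFDeriv ℝ 1 (fun s : ℝ => s) t‖ = 1 := by
    rw [norm_iteratedFDeriv_eq_norm_iteratedDeriv, iteratedDeriv_one]; simp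
  have h2 : ∀ i, ‖iteratedFDeriv ℝ (i + 1 + 1) (fun s : ℝ => s) t‖ = 0 := by
    intro i
    rw [norm_iteratedFDeriv_eq_norm_iteratedDeriv, iteratedDeriv_succ']
    have : deriv (fun s : ℝ => s) = fun _ => 1 := by ext s; simp
    rw [this, iteratedDeriv_const]; simp
  rw [Finset.sum_range_succ', Finset.sum_range_succ']
  simp only [h2]
  simp [h1]
  ring

/-- Bounds on the first `k` derivatives pass from `a` and `y` to the solution `x` of the linear
equation `a x = y`, linearly in the bound on `y`. Induction on `k`: the derivative of `x` solves
the equation `a x' = y' - a' x`. -/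
theorem exists_norm_iteratedFDeriv_le_of_clm_apply_eq (k : ℕ) (C A : ℝ) (hC : 0 ≤ C)
    (hA : 0 ≤ A) :
    ∃ R : ℝ, 0 ≤ R ∧ ∀ (δ Y t : ℝ) (a : ℝ → E →L[ℝ] F) (x : ℝ → E) (y : ℝ → F),
      0 ≤ δ → 0 ≤ Y →
      ContDiffAt ℝ k a t → ContDiffAt ℝ k x t → ContDiffAt ℝ k y t →
      (∀ j ≤ k, ‖iteratedFDeriv ℝ j a t‖ ≤ A * δ ^ j) →
      (∀ j ≤ k, ‖iteratedFDeriv ℝ j y t‖ ≤ Y * δ ^ j) →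
      (∀ v, ‖v‖ ≤ C * ‖a t v‖) → (∀ᶠ s in 𝓝 t, a s (x s) = y s) →
      ∀ j ≤ k, ‖iteratedFDeriv ℝ j x t‖ ≤ R * Y * δ ^ j := by
  induction k with
  | zero =>
    refine ⟨C, hC, ?_⟩
    intro δ Y t a x y hδ hY ha hx hy hja hjy hv heq j hj
    obtain rfl : j = 0 := by omega
    have h1 := hjy 0 le_rfl
    simp only [norm_iteratedFDeriv_zero, pow_zero, mul_one] at h1 ⊢
    calc ‖x t‖ ≤ C * ‖a t (x t)‖ := hv _
      _ = C * ‖y t‖ := by rw [heq.self_of_nhds]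
      _ ≤ C * Y := by gcongr
  | succ k ih =>
    obtain ⟨R, hR, ih⟩ := ih
    refine ⟨R * (1 + 2 ^ k * A * R) + R, by positivity, ?_⟩
    intro δ Y t a x y hδ hY ha hx hy hja hjy hv heq j hj
    have hk : ((k : ℕ) : WithTop ℕ∞) ≤ ((k + 1 : ℕ) : WithTop ℕ∞) := by
      exact_mod_cast Nat.le_succ k
    have hx0 := ih δ Y t a x y hδ hY (ha.of_le hk) (hx.of_le hk) (hy.of_le hk)
      (fun i hi => hja i (by omega)) (fun i hi => hjy i (by omega)) hv heq
    have hRY : R * Y ≤ (R * (1 + 2 ^ k * A * R) + R) * Y := by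
      gcongr; have : 0 ≤ R * (1 + 2 ^ k * A * R) := by positivity
      linarith
    rcases j with _ | j
    · exact (hx0 0 (by omega)).trans (by gcongr)
    have hj' : j ≤ k := by omega
    have hda := contDiffAt_deriv ha
    have hdx := contDiffAt_deriv hx
    have hdy := contDiffAt_deriv hy
    have h1 : ((k + 1 : ℕ) : WithTop ℕ∞) ≠ 0 := by exact_mod_cast Nat.succ_ne_zero k
    have heq' : ∀ᶠ s in 𝓝 t, a s (deriv x s) = deriv y s - deriv a s (x s) := by
      filter_upwards [heq.eventually_nhds, ha.eventually (by simp), hx.eventually (by simp)]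
        with s hs has hxs
      have hd := (has.differentiableAt h1).hasDerivAt.clm_apply (hxs.differentiableAt h1).hasDerivAt
      have := (hd.congr_of_eventuallyEq (EventuallyEq.symm hs)).deriv
      rw [this]; abel
    have hprod : ∀ i ≤ k, ‖iteratedFDeriv ℝ i (fun s => deriv a s (x s)) t‖ ≤
        2 ^ k * A * R * Y * δ * δ ^ i := by
      intro i hi
      have hik : ((i : ℕ) : WithTop ℕ∞) ≤ k := by exact_mod_cast hi
      refine (norm_iteratedFDeriv_clm_apply_at (hda.of_le hik)
        ((hx.of_le hk).of_le hik)).trans ?_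
      calc ∑ m ∈ Finset.range (i + 1), (i.choose m : ℝ) * ‖iteratedFDeriv ℝ m (deriv a) t‖ *
            ‖iteratedFDeriv ℝ (i - m) x t‖
          ≤ ∑ m ∈ Finset.range (i + 1), (i.choose m : ℝ) * (A * R * Y * δ * δ ^ i) := by
            refine Finset.sum_le_sum fun m hm => ?_
            have hm : m ≤ i := by simpa [Nat.lt_succ_iff] using hm
            rw [norm_iteratedFDeriv_deriv, mul_assoc]
            refine mul_le_mul_of_nonneg_left ?_ (by positivity)
            calc _ ≤ (A * δ ^ (m + 1)) * (R * Y * δ ^ (i - m)) :=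
                  mul_le_mul (hja _ (by omega)) (hx0 _ (by omega)) (norm_nonneg _) (by positivity)
              _ = A * R * Y * δ * (δ ^ m * δ ^ (i - m)) := by ring
              _ = _ := by rw [← pow_add, Nat.add_sub_cancel' hm]
        _ = 2 ^ i * (A * R * Y * δ * δ ^ i) := by
            rw [← Finset.sum_mul]; congr 1
            exact_mod_cast Nat.sum_range_choose i
        _ ≤ 2 ^ k * (A * R * Y * δ * δ ^ i) := by
            gcongr; norm_num
        _ = _ := by ring
    have hax : ContDiffAt ℝ k (fun s => deriv a s (x s)) t := hda.clm_apply (hx.of_le hk)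
    have hy1 : ∀ i ≤ k, ‖iteratedFDeriv ℝ i (fun s => deriv y s - deriv a s (x s)) t‖ ≤
        ((1 + 2 ^ k * A * R) * Y * δ) * δ ^ i := by
      intro i hi
      have hik : ((i : ℕ) : WithTop ℕ∞) ≤ k := by exact_mod_cast hi
      rw [fun_iteratedFDeriv_sub_apply (hdy.of_le hik) (hax.of_le hik)]
      refine (norm_sub_le _ _).trans ?_
      have h2 := hjy (i + 1) (by omega)
      rw [← norm_iteratedFDeriv_deriv] at h2
      calc _ ≤ Y * δ ^ (i + 1) + 2 ^ k * A * R * Y * δ * δ ^ i := add_le_add h2 (hprod i hi)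
        _ = _ := by ring
    have := ih δ ((1 + 2 ^ k * A * R) * Y * δ) t a (deriv x) _ hδ (by positivity)
      (ha.of_le hk) hdx (hdy.sub hax) (fun i hi => hja i (by omega)) hy1 hv heq' j hj'
    rw [norm_iteratedFDeriv_deriv] at this
    calc _ ≤ _ := this
      _ = R * (1 + 2 ^ k * A * R) * Y * δ ^ (j + 1) := by ring
      _ ≤ _ := by gcongr; linarith

end Jets

/-! ### Derivatives of a curve defined by an implicit equation -/

section Curve

variable {E G : Type*} [NormedAddCommGroup E] [NormedSpace ℝ E]
  [NormedAddCommGroup G] [NormedSpace ℝ G]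

/-- Differentiating `F (x t) = t • u (x t)` yields a linear equation for `x'`. -/
theorem eventually_clm_apply_deriv_eq {F u : E → G} {x : ℝ → E} {t : ℝ} {n : ℕ}
    (hF : ContDiffAt ℝ ((n + 1 : ℕ) : WithTop ℕ∞) F (x t))
    (hu : ContDiffAt ℝ ((n + 1 : ℕ) : WithTop ℕ∞) u (x t))
    (hx : ContDiffAt ℝ ((n + 1 : ℕ) : WithTop ℕ∞) x t)
    (heq : ∀ᶠ s in 𝓝 t, F (x s) = s • u (x s)) :
    ∀ᶠ s in 𝓝 t, (fderiv ℝ F (x s) - s • fderiv ℝ u (x s)) (deriv x s) = u (x s) := by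
  have h1 : ((n + 1 : ℕ) : WithTop ℕ∞) ≠ 0 := by exact_mod_cast Nat.succ_ne_zero n
  filter_upwards [heq.eventually_nhds, hx.eventually (by simp),
    hx.continuousAt.eventually (hF.eventually (by simp)),
    hx.continuousAt.eventually (hu.eventually (by simp))] with s hs hxs hFs hus
  have hxd := (hxs.differentiableAt h1).hasDerivAt
  have hFd := (hFs.differentiableAt h1).hasFDerivAt.comp_hasDerivAt s hxd
  have hud := (hus.differentiableAt h1).hasFDerivAt.comp_hasDerivAt s hxd
  have hsd := (hasDerivAt_id s).smul hud
  have h := hFd.unique (hsd.congr_of_eventuallyEq hs)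
  simp only [_root_.sub_apply, _root_.smul_apply]
  rw [h]
  simp

/-- The Faà di Bruno bound along a curve whose `i`-th derivative is `O(δ ^ i)`. -/
theorem norm_iteratedFDeriv_comp_curve_le {φ : E → G} {x : ℝ → E} {t R B δ : ℝ} {i k : ℕ}
    (hR : 1 ≤ R) (hδ : 0 ≤ δ) (hB : 0 ≤ B) (hik : i ≤ k)
    (hφ : ContDiffAt ℝ k φ (x t)) (hx : ContDiffAt ℝ k x t)
    (hφb : ∀ m ≤ i, ‖iteratedFDeriv ℝ m φ (x t)‖ ≤ B)
    (hxb : ∀ m, 1 ≤ m → m ≤ k → ‖iteratedFDeriv ℝ m x t‖ ≤ R * δ ^ m) :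
    ‖iteratedFDeriv ℝ i (fun s => φ (x s)) t‖ ≤ k.factorial * R ^ k * B * δ ^ i := by
  have hik' : ((i : ℕ) : WithTop ℕ∞) ≤ k := by exact_mod_cast hik
  refine (norm_iteratedFDeriv_comp_at (D := R * δ) (hφ.of_le hik') (hx.of_le hik') hφb
    (fun m h1 h2 => ?_)).trans ?_
  · rw [mul_pow]
    refine (hxb m h1 (h2.trans hik)).trans ?_
    gcongr
    exact le_self_pow₀ hR (by omega)
  · rw [mul_pow]
    calc (i.factorial : ℝ) * B * (R ^ i * δ ^ i)
        ≤ k.factorial * B * (R ^ k * δ ^ i) := by gcongr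
      _ = _ := by ring

/-- If `F (x t) = t • u (x t)`, where the derivatives of `F` are bounded and those of `u` are
`O(δ)` up to the order `K` and bounded for the order `K + 1`, then the `j`-th derivative of the
curve `x` is `O(δ ^ j)` for `j ≤ K + 1`. The derivative of order `K + 1` of `u` only ever occurs
multiplied by `K + 1` derivatives of `x`, which is why it may be of order one. -/
theorem exists_norm_iteratedFDeriv_curve_le (K : ℕ) (C A : ℝ) (hC : 0 ≤ C) (hA : 0 ≤ A) :
    ∃ R : ℝ, 0 ≤ R ∧ ∀ (δ t : ℝ) (F u : E → G) (x : ℝ → E),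
      0 ≤ δ → δ ≤ 1 → |t| ≤ 1 →
      ContDiffAt ℝ ((K + 1 : ℕ) : WithTop ℕ∞) F (x t) →
      ContDiffAt ℝ ((K + 1 : ℕ) : WithTop ℕ∞) u (x t) →
      ContDiffAt ℝ ((K + 1 : ℕ) : WithTop ℕ∞) x t →
      (∀ᶠ s in 𝓝 t, F (x s) = s • u (x s)) →
      (∀ j, 1 ≤ j → j ≤ K + 1 → ‖iteratedFDeriv ℝ j F (x t)‖ ≤ A) →
      (∀ j ≤ K, ‖iteratedFDeriv ℝ j u (x t)‖ ≤ A * δ) →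
      ‖iteratedFDeriv ℝ (K + 1) u (x t)‖ ≤ A →
      (∀ v, ‖v‖ ≤ C * ‖(fderiv ℝ F (x t) - t • fderiv ℝ u (x t)) v‖) →
      ∀ j, 1 ≤ j → j ≤ K + 1 → ‖iteratedFDeriv ℝ j x t‖ ≤ R * δ ^ j := by
  suffices H : ∀ k ≤ K + 1, ∃ R : ℝ, 1 ≤ R ∧ ∀ (δ t : ℝ) (F u : E → G) (x : ℝ → E),
      0 ≤ δ → δ ≤ 1 → |t| ≤ 1 →
      ContDiffAt ℝ ((K + 1 : ℕ) : WithTop ℕ∞) F (x t) →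
      ContDiffAt ℝ ((K + 1 : ℕ) : WithTop ℕ∞) u (x t) →
      ContDiffAt ℝ ((K + 1 : ℕ) : WithTop ℕ∞) x t →
      (∀ᶠ s in 𝓝 t, F (x s) = s • u (x s)) →
      (∀ j, 1 ≤ j → j ≤ K + 1 → ‖iteratedFDeriv ℝ j F (x t)‖ ≤ A) →
      (∀ j ≤ K, ‖iteratedFDeriv ℝ j u (x t)‖ ≤ A * δ) →
      ‖iteratedFDeriv ℝ (K + 1) u (x t)‖ ≤ A →
      (∀ v, ‖v‖ ≤ C * ‖(fderiv ℝ F (x t) - t • fderiv ℝ u (x t)) v‖) →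
      ∀ j, 1 ≤ j → j ≤ k → ‖iteratedFDeriv ℝ j x t‖ ≤ R * δ ^ j by
    obtain ⟨R, hR, h⟩ := H (K + 1) le_rfl
    exact ⟨R, by linarith, h⟩
  intro k
  induction k with
  | zero => exact fun _ => ⟨1, le_rfl, fun _ _ _ _ _ _ _ _ _ _ _ _ _ _ _ _ j h1 h2 => by omega⟩
  | succ k ih =>
    intro hkK
    obtain ⟨R, hR, ih⟩ := ih (by omega)
    set Q : ℝ := k.factorial * R ^ k * A with hQ
    have hQ0 : 0 ≤ Q := by positivity
    obtain ⟨S, hS, hsolve⟩ := exists_norm_iteratedFDeriv_le_of_clm_apply_eq (E := E) (F := G) k C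
      (Q + (Q + k * Q)) hC (by positivity)
    refine ⟨max R (S * Q), le_max_of_le_left hR, ?_⟩
    intro δ t F u x hδ hδ1 ht hF hu hx heq hFb hub hub' hv j hj1 hjk
    have hk1 : ((k : ℕ) : WithTop ℕ∞) ≤ ((K + 1 : ℕ) : WithTop ℕ∞) := by
      exact_mod_cast (by omega : k ≤ K + 1)
    have hk2 : ((k : ℕ) : WithTop ℕ∞) + 1 ≤ ((K + 1 : ℕ) : WithTop ℕ∞) := by
      exact_mod_cast hkK
    have hder := ih δ t F u x hδ hδ1 ht hF hu hx heq hFb hub hub' hv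
    have hF' : ContDiffAt ℝ k (fderiv ℝ F) (x t) := hF.fderiv_right hk2
    have hu' : ContDiffAt ℝ k (fderiv ℝ u) (x t) := hu.fderiv_right hk2
    have hxk := hx.of_le hk1
    have hFx : ContDiffAt ℝ k (fun s => fderiv ℝ F (x s)) t := hF'.comp t hxk
    have hux' : ContDiffAt ℝ k (fun s => fderiv ℝ u (x s)) t := hu'.comp t hxk
    have hux : ContDiffAt ℝ k (fun s => u (x s)) t := (hu.of_le hk1).comp t hxk
    have htux : ContDiffAt ℝ k (fun s => s • fderiv ℝ u (x s)) t := contDiffAt_id.smul hux'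
    have hub1 : ∀ m ≤ K + 1, ‖iteratedFDeriv ℝ m u (x t)‖ ≤ A := by
      intro m hm
      rcases Nat.lt_or_ge m (K + 1) with h | h
      · exact (hub m (by omega)).trans (mul_le_of_le_one_right hA hδ1)
      · obtain rfl : m = K + 1 := by omega
        exact hub'
    have hja : ∀ i ≤ k, ‖iteratedFDeriv ℝ i
        (fun s => fderiv ℝ F (x s) - s • fderiv ℝ u (x s)) t‖ ≤ (Q + (Q + k * Q)) * δ ^ i := by
      intro i hi
      have hik : ((i : ℕ) : WithTop ℕ∞) ≤ k := by exact_mod_cast hi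
      rw [fun_iteratedFDeriv_sub_apply (hFx.of_le hik) (htux.of_le hik)]
      refine (norm_sub_le _ _).trans ?_
      rw [add_mul]
      refine add_le_add ?_ ?_
      · refine norm_iteratedFDeriv_comp_curve_le hR hδ hA hi hF' hxk (fun m hm => ?_) hder
        rw [norm_iteratedFDeriv_fderiv]
        exact hFb _ (by omega) (by omega)
      · have h1 : ‖iteratedFDeriv ℝ i (fun s => fderiv ℝ u (x s)) t‖ ≤ Q * δ ^ i := by
          refine norm_iteratedFDeriv_comp_curve_le hR hδ hA hi hu' hxk (fun m hm => ?_) hder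
          rw [norm_iteratedFDeriv_fderiv]
          exact hub1 _ (by omega)
        rcases i with _ | i
        · simp only [norm_iteratedFDeriv_zero, norm_smul, Real.norm_eq_abs, pow_zero,
            mul_one] at h1 ⊢
          calc |t| * ‖fderiv ℝ u (x t)‖ ≤ 1 * Q := by gcongr
            _ ≤ Q + k * Q := by
              have : 0 ≤ (k : ℝ) * Q := by positivity
              linarith
        · refine (norm_iteratedFDeriv_id_smul_le (hux'.of_le hik)).trans ?_
          -- below the top order a derivative of `u` contributes the missing factor `δ`
          have h2 : ‖iteratedFDeriv ℝ i (fun s => fderiv ℝ u (x s)) t‖ ≤ Q * δ * δ ^ i := by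
            rw [hQ, mul_assoc _ A δ]
            refine norm_iteratedFDeriv_comp_curve_le hR hδ (by positivity) (by omega) hu' hxk
              (fun m hm => ?_) hder
            rw [norm_iteratedFDeriv_fderiv]
            exact hub _ (by omega)
          have h3 : ((i : ℝ) + 1) ≤ k := by exact_mod_cast hi
          calc _ ≤ 1 * (Q * δ ^ (i + 1)) + k * (Q * δ * δ ^ i) := by gcongr
            _ = _ := by ring
    have hjy : ∀ i ≤ k, ‖iteratedFDeriv ℝ i (fun s => u (x s)) t‖ ≤ Q * δ * δ ^ i := by
      intro i hi
      rw [hQ, mul_assoc _ A δ]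
      exact norm_iteratedFDeriv_comp_curve_le hR hδ (by positivity) hi (hu.of_le hk1) hxk
        (fun m hm => hub m (by omega)) hder
    have hx' : ContDiffAt ℝ k (deriv x) t :=
      contDiffAt_deriv (hx.of_le (by exact_mod_cast hkK))
    have hfin := hsolve δ (Q * δ) t _ (deriv x) _ hδ (by positivity) (hFx.sub htux) hx' hux hja hjy
      hv (eventually_clm_apply_deriv_eq hF hu hx heq)
    obtain ⟨i, rfl⟩ : ∃ i, j = i + 1 := ⟨j - 1, by omega⟩
    have := hfin i (by omega)
    rw [norm_iteratedFDeriv_deriv] at this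
    calc _ ≤ _ := this
      _ = (S * Q) * δ ^ (i + 1) := by ring
      _ ≤ _ := by gcongr; exact le_max_right _ _

end Curve

/-! ### Strongly monotone maps, and Taylor's theorem along a line -/

section Analysis

variable {E G W : Type*} [NormedAddCommGroup E] [InnerProductSpace ℝ E]
  [NormedAddCommGroup G] [NormedSpace ℝ G] [NormedAddCommGroup W] [NormedSpace ℝ W]

/-- A strongly monotone map is expansive. -/
theorem norm_sub_le_of_inner_fderiv {Ω : Set E} (hΩ : Convex ℝ Ω) {F : E → E} {C : ℝ}
    (hC : 0 ≤ C) (hF : ∀ θ ∈ Ω, DifferentiableAt ℝ F θ)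
    (hmono : ∀ θ ∈ Ω, ∀ v, ‖v‖ ^ 2 ≤ C * inner ℝ v (fderiv ℝ F θ v)) {a b : E}
    (ha : a ∈ Ω) (hb : b ∈ Ω) : ‖a - b‖ ≤ C * ‖F a - F b‖ := by
  have hmem : ∀ s ∈ Set.Icc (0 : ℝ) 1, b + s • (a - b) ∈ Ω := by
    intro s hs
    have := hΩ hb ha (sub_nonneg.2 hs.2) hs.1 (by ring)
    convert this using 1
    module
  have hd : ∀ s ∈ Set.Icc (0 : ℝ) 1, HasDerivAt (fun s => inner ℝ (a - b) (F (b + s • (a - b))))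
      (inner ℝ (a - b) (fderiv ℝ F (b + s • (a - b)) (a - b))) s := by
    intro s hs
    have h1 : HasDerivAt (fun s : ℝ => b + s • (a - b)) (a - b) s := by
      simpa using ((hasDerivAt_id s).smul_const (a - b)).const_add b
    have h2 := (hF _ (hmem s hs)).hasFDerivAt.comp_hasDerivAt s h1
    simpa using (hasDerivAt_const s (a - b)).inner ℝ h2
  obtain ⟨c, hc, hcs⟩ := exists_hasDerivAt_eq_slope _ _ zero_lt_one
    (fun s hs => (hd s hs).continuousAt.continuousWithinAt)
    (fun s hs => hd s (Set.Ioo_subset_Icc_self hs))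
  have h3 := hmono _ (hmem c (Set.Ioo_subset_Icc_self hc)) (a - b)
  rw [hcs] at h3
  simp only [one_smul, zero_smul, add_zero, sub_zero, div_one, add_sub_cancel, ← inner_sub_right]
    at h3
  have h4 : inner ℝ (a - b) (F a - F b) ≤ ‖a - b‖ * ‖F a - F b‖ := real_inner_le_norm _ _
  have h5 : ‖a - b‖ * ‖a - b‖ ≤ ‖a - b‖ * (C * ‖F a - F b‖) := by
    calc _ = ‖a - b‖ ^ 2 := by ring
      _ ≤ C * (‖a - b‖ * ‖F a - F b‖) := h3.trans (by gcongr)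
      _ = _ := by ring
  rcases (norm_nonneg (a - b)).eq_or_lt with h | h
  · rw [← h]; positivity
  · exact le_of_mul_le_mul_left h5 h

theorem norm_le_of_inner_le {T : E →L[ℝ] E} {C : ℝ} (hC : 0 ≤ C) {v : E}
    (h : ‖v‖ ^ 2 ≤ C * inner ℝ v (T v)) : ‖v‖ ≤ C * ‖T v‖ := by
  have h5 : ‖v‖ * ‖v‖ ≤ ‖v‖ * (C * ‖T v‖) := by
    calc _ = ‖v‖ ^ 2 := by ring
      _ ≤ C * (‖v‖ * ‖T v‖) := h.trans (by gcongr; exact real_inner_le_norm _ _)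
      _ = _ := by ring
  rcases (norm_nonneg v).eq_or_lt with h | h
  · rw [← h]; positivity
  · exact le_of_mul_le_mul_left h5 h

/-- The lower bound of `T` survives a perturbation that is small relative to it. -/
theorem norm_le_two_mul_of_le {V : Type*} [NormedAddCommGroup V] {p q r v : V} {C c : ℝ}
    (hC : 0 ≤ C) (hCc : C * c ≤ 1 / 2)
    (h : ‖v‖ ≤ C * ‖p‖) (hq : ‖q‖ ≤ c * ‖v‖) (hr : p = r + q) : ‖v‖ ≤ 2 * C * ‖r‖ := by
  have h1 : ‖p‖ ≤ ‖r‖ + c * ‖v‖ := by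
    rw [hr]; exact (norm_add_le _ _).trans (by gcongr)
  have h2 : C * ‖p‖ ≤ C * (‖r‖ + c * ‖v‖) := by gcongr
  nlinarith [norm_nonneg v]

theorem isInvertible_of_norm_le [FiniteDimensional ℝ E] {T : E →L[ℝ] E}
    {C : ℝ} (h : ∀ v, ‖v‖ ≤ C * ‖T v‖) : T.IsInvertible := by
  have hinj : Function.Injective (T : E →ₗ[ℝ] E) := by
    rw [← LinearMap.ker_eq_bot, LinearMap.ker_eq_bot']
    intro v hv
    have := h v
    have hv' : T v = 0 := hv
    rw [hv'] at this
    simpa using this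
  exact ⟨(LinearEquiv.ofInjectiveEndo _ hinj).toContinuousLinearEquiv, by ext; simp⟩

theorem norm_iteratedFDeriv_sub_le {Ω : Set E} (hΩ : Convex ℝ Ω) {u : E → G} {k : ℕ} {B : ℝ}
    (hu : ∀ θ ∈ Ω, ContDiffAt ℝ ((k + 1 : ℕ) : WithTop ℕ∞) u θ)
    (hB : ∀ θ ∈ Ω, ‖iteratedFDeriv ℝ (k + 1) u θ‖ ≤ B) {a b : E} (ha : a ∈ Ω) (hb : b ∈ Ω) :
    ‖iteratedFDeriv ℝ k u a - iteratedFDeriv ℝ k u b‖ ≤ B * ‖a - b‖ := by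
  refine hΩ.norm_image_sub_le_of_norm_fderiv_le (𝕜 := ℝ) (fun θ hθ => ?_) (fun θ hθ => ?_) hb ha
  · exact (hu θ hθ).differentiableAt_iteratedFDeriv (by exact_mod_cast Nat.lt_succ_self k)
  · rw [norm_fderiv_iteratedFDeriv]; exact hB θ hθ

/-- Directional derivatives are derivatives along the line. -/
theorem iteratedFDeriv_apply_const_eq_iteratedDeriv {f : W → G} {w v : W} {k : ℕ}
    (hf : ContDiffAt ℝ k f w) :
    iteratedFDeriv ℝ k f w (fun _ => v) = iteratedDeriv k (fun t : ℝ => f (w + t • v)) 0 := by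
  have h0 : iteratedFDeriv ℝ k f w = iteratedFDeriv ℝ k (fun z => f (w + z)) 0 := by
    rw [iteratedFDeriv_comp_add_left]; simp
  have hf0 : ContDiffAt ℝ k (fun z => f (w + z)) 0 := by
    refine ContDiffAt.comp (0 : W) (g := f) (by simpa using hf) ?_
    exact contDiffAt_const.add contDiffAt_id
  obtain ⟨U, hU, h0U, hfU⟩ := hf0.contDiffOn' le_rfl (by simp)
  let L : ℝ →L[ℝ] W := (1 : ℝ →L[ℝ] ℝ).smulRight v
  have hLU : IsOpen (L ⁻¹' U) := hU.preimage L.continuous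
  have hL0 : L 0 ∈ U := by simpa using h0U
  have hx : (0 : ℝ) ∈ L ⁻¹' U := hL0
  have h := L.iteratedFDerivWithin_comp_right (s := U) (n := k) (i := k) (x := 0)
    (hfU.mono fun y hy => ⟨Set.mem_insert_of_mem _ (Set.mem_univ _), hy⟩)
    hU.uniqueDiffOn hLU.uniqueDiffOn hL0 le_rfl
  rw [iteratedFDerivWithin_of_isOpen _ hLU hx, iteratedFDerivWithin_of_isOpen _ hU hL0] at h
  rw [h0, iteratedDeriv_eq_iteratedFDeriv]
  have h1 : (fun t : ℝ => f (w + t • v)) = (fun z => f (w + z)) ∘ L := by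
    ext t; simp [L]
  rw [h1, h]
  simp [L]

/-- Taylor's theorem at `1` for a curve that is smooth at every point of the unit interval. -/
theorem norm_taylor_unit_le {x : ℝ → G} {K : ℕ} {B : ℝ}
    (hx : ∀ t ∈ Set.Icc (0 : ℝ) 1, ContDiffAt ℝ ((K + 1 : ℕ) : WithTop ℕ∞) x t)
    (hB : ∀ t ∈ Set.Icc (0 : ℝ) 1, ‖iteratedFDeriv ℝ (K + 1) x t‖ ≤ B) :
    ‖x 0 + ∑ k ∈ Finset.Icc 1 K, (1 / (k.factorial : ℝ)) • iteratedDeriv k x 0 - x 1‖ ≤ B := by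
  have hud : UniqueDiffOn ℝ (Set.Icc (0 : ℝ) 1) := uniqueDiffOn_Icc zero_lt_one
  have h0 : (0 : ℝ) ∈ Set.Icc (0 : ℝ) 1 := by simp
  have hB0 : 0 ≤ B := (norm_nonneg _).trans (hB 0 h0)
  have h := taylor_mean_remainder_bound (f := x) (n := K) (C := B) (x := 1) zero_le_one
    (fun t ht => by exact_mod_cast (hx t ht).contDiffWithinAt) (by simp)
    (fun t ht => by
      rw [iteratedDerivWithin_eq_iteratedDeriv hud (hx t ht) ht,
        ← norm_iteratedFDeriv_eq_norm_iteratedDeriv]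
      exact hB t ht)
  rw [taylor_within_apply] at h
  have hsum : ∑ k ∈ Finset.range (K + 1), (((k.factorial : ℝ)⁻¹ * (1 - 0) ^ k) •
      iteratedDerivWithin k x (Set.Icc 0 1) 0) =
      x 0 + ∑ k ∈ Finset.Icc 1 K, (1 / (k.factorial : ℝ)) • iteratedDeriv k x 0 := by
    rw [Finset.range_eq_Ico, Finset.sum_eq_sum_Ico_succ_bot (by omega)]
    congr 1
    · simp
    · refine Finset.sum_congr (by ext; simp) fun k hk => ?_
      have hk' : k ≤ K + 1 := by simp at hk; omega
      rw [iteratedDerivWithin_eq_iteratedDeriv hud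
        ((hx 0 h0).of_le (by exact_mod_cast hk')) h0]
      simp
  rw [hsum] at h
  rw [norm_sub_rev]
  refine h.trans ?_
  rw [sub_zero, one_pow, mul_one]
  exact div_le_self hB0 (by exact_mod_cast Nat.one_le_iff_ne_zero.2 K.factorial_ne_zero)

end Analysis

/-! ### The estimating equation and its solutions -/

section EstimatingEquation

variable {D N : ℕ}

theorem estEq_sub_estEq (g : ℕ → Param D → Param D) (θ : Param D) (w w' : Weight N) :
    estEq N g θ w - estEq N g θ w' =
      (1 / (N : ℝ)) • ∑ i : Fin N, (w i - w' i) • g ((i : ℕ) + 1) θ := by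
  simp only [estEq, ← smul_sub, sub_smul, Finset.sum_sub_distrib]
  congr 1
  abel

/-- On the line through `1_N` and a leave-one-out weight, only one datum changes its weight. -/
theorem estEq_segment (g : ℕ → Param D → Param D) (θ : Param D) (n : Fin N) (t : ℝ) :
    estEq N g θ (ones N + t • (looWeight n - ones N)) =
      estEq N g θ (ones N) - t • ((1 / (N : ℝ)) • g ((n : ℕ) + 1) θ) := by
  have h := estEq_sub_estEq g θ (ones N + t • (looWeight n - ones N)) (ones N)
  have hs : ∑ i : Fin N, ((ones N + t • (looWeight n - ones N)) i - (ones N) i) •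
      g ((i : ℕ) + 1) θ = -(t • g ((n : ℕ) + 1) θ) := by
    rw [Finset.sum_eq_single n]
    · simp [ones, looWeight]
    · intro i _ hi
      simp [ones, looWeight, hi]
    · simp
  rw [hs] at h
  rw [eq_add_of_sub_eq h, smul_neg, smul_comm]
  abel

theorem isOpen_weightDomain (w : Weight N) (η : ℝ) : IsOpen (weightDomain w η) := by
  have : weightDomain w η = ⋃ t ∈ Set.Icc (0 : ℝ) 1, Metric.ball ((1 - t) • ones N + t • w) η := by
    ext w'
    simp [weightDomain, dist_eq_norm]
  rw [this]
  exact isOpen_biUnion fun t _ => Metric.isOpen_ball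

theorem segment_mem_weightDomain {w : Weight N} {η t : ℝ} (hη : 0 < η)
    (ht : t ∈ Set.Icc (0 : ℝ) 1) : ones N + t • (w - ones N) ∈ weightDomain w η := by
  refine ⟨t, ht, ?_⟩
  have : ones N + t • (w - ones N) - ((1 - t) • ones N + t • w) = 0 := by module
  rw [this, norm_zero]
  exact hη

theorem contDiffAt_estEq {g : ℕ → Param D → Param D} {m : ℕ} {θ : Param D}
    (hg : ∀ n ≤ N, ContDiffAt ℝ m (g n) θ) (w : Weight N) :
    ContDiffAt ℝ m (fun v : Weight N × Param D => estEq N g v.2 v.1) (w, θ) := by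
  unfold estEq
  have h : ∀ n ≤ N, ContDiffAt ℝ m (fun v : Weight N × Param D => g n v.2) (w, θ) := fun n hn =>
    ContDiffAt.comp (w, θ) (g := g n) (hg n hn) contDiffAt_snd
  refine ContDiffAt.const_smul _ ((h 0 (by omega)).add (ContDiffAt.sum fun i _ => ?_))
  have hc : ContDiffAt ℝ m (fun v : Weight N × Param D => v.1 i) (w, θ) :=
    ((EuclideanSpace.proj (𝕜 := ℝ) i).contDiff.comp contDiff_fst).contDiffAt
  exact hc.smul (h _ i.2)

theorem contDiffAt_estEq_right {g : ℕ → Param D → Param D} {m : ℕ} {θ : Param D}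
    (hg : ∀ n ≤ N, ContDiffAt ℝ m (g n) θ) (w : Weight N) :
    ContDiffAt ℝ m (fun θ' => estEq N g θ' w) θ :=
  ContDiffAt.comp θ (f := fun θ' => (w, θ')) (contDiffAt_estEq hg w)
    (contDiffAt_const.prodMk contDiffAt_id)

/-- A solution of the estimating equation near `w` is continuous at `w`, if the estimating
function with weight `w` is expansive and the data functions grow at most linearly. -/
theorem continuousAt_of_estEq_eq_zero (hN : 1 ≤ N) {g : ℕ → Param D → Param D}
    {θhat : Weight N → Param D} {w : Weight N} {Ωθ : Set (Param D)} {C L : ℝ} (hC : 0 ≤ C)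
    (hsol : ∀ᶠ w' in 𝓝 w, θhat w' ∈ Ωθ ∧ estEq N g (θhat w') w' = 0)
    (hexp : ∀ θ ∈ Ωθ, ‖θ - θhat w‖ ≤ C * ‖estEq N g θ w - estEq N g (θhat w) w‖)
    (hlip : ∀ i : Fin N, ∀ θ ∈ Ωθ, ‖g (i + 1) θ - g (i + 1) (θhat w)‖ ≤ L * ‖θ - θhat w‖) :
    ContinuousAt θhat w := by
  set A := ∑ i : Fin N, ‖g (i + 1) (θhat w)‖ with hA
  have hA0 : 0 ≤ A := Finset.sum_nonneg fun _ _ => norm_nonneg _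
  set s : Weight N → ℝ := fun w' => ∑ i : Fin N, |w i - w' i| with hs
  have hs0 : ∀ w', 0 ≤ s w' := fun w' => Finset.sum_nonneg fun _ _ => abs_nonneg _
  have hst : Tendsto s (𝓝 w) (𝓝 0) := by
    have hc : Continuous s := by
      refine continuous_finsetSum _ fun i _ => (continuous_const.sub ?_).abs
      exact (EuclideanSpace.proj (𝕜 := ℝ) i).continuous
    simpa [hs] using hc.tendsto w
  have hsmall : ∀ᶠ w' in 𝓝 w, C * L * s w' < 1 / 2 := by
    have := hst.const_mul (C * L)
    rw [mul_zero] at this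
    exact this.eventually_lt_const (by norm_num)
  have h0 : estEq N g (θhat w) w = 0 := hsol.self_of_nhds.2
  rw [ContinuousAt, tendsto_iff_norm_sub_tendsto_zero]
  have hlim : Tendsto (fun w' => 2 * C * A * s w') (𝓝 w) (𝓝 0) := by
    simpa using hst.const_mul (2 * C * A)
  refine squeeze_zero' (Eventually.of_forall fun _ => norm_nonneg _) ?_ hlim
  filter_upwards [hsol, hsmall] with w' hw' hsw
  set Δ := ‖θhat w' - θhat w‖ with hΔ
  have hΔ0 : 0 ≤ Δ := norm_nonneg _
  have h1 : ‖estEq N g (θhat w') w - estEq N g (θhat w) w‖ ≤ s w' * (A + L * Δ) := by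
    rw [h0, ← hw'.2, estEq_sub_estEq, norm_smul]
    have hN' : ‖1 / (N : ℝ)‖ ≤ 1 := by
      rw [Real.norm_eq_abs, abs_of_nonneg (by positivity)]
      exact div_le_one_of_le₀ (by exact_mod_cast hN) (by positivity)
    calc ‖1 / (N : ℝ)‖ * ‖∑ i : Fin N, (w i - w' i) • g (i + 1) (θhat w')‖
        ≤ 1 * ∑ i : Fin N, |w i - w' i| * (A + L * Δ) := by
          refine mul_le_mul hN' ?_ (norm_nonneg _) zero_le_one
          refine norm_sum_le_of_le _ fun i _ => ?_
          rw [norm_smul, Real.norm_eq_abs]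
          refine mul_le_mul_of_nonneg_left ?_ (abs_nonneg _)
          calc ‖g (i + 1) (θhat w')‖
              = ‖g (i + 1) (θhat w) + (g (i + 1) (θhat w') - g (i + 1) (θhat w))‖ := by
                rw [add_sub_cancel]
            _ ≤ A + L * Δ := by
              refine (norm_add_le _ _).trans (add_le_add ?_ (hlip i _ hw'.1))
              exact Finset.single_le_sum (f := fun i : Fin N => ‖g (i + 1) (θhat w)‖)
                (fun _ _ => norm_nonneg _) (Finset.mem_univ i)
      _ = _ := by rw [one_mul, ← Finset.sum_mul]
  have h2 : Δ ≤ C * (s w' * (A + L * Δ)) := (hexp _ hw'.1).trans (by gcongr)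
  have h3 : C * L * s w' * Δ ≤ 1 / 2 * Δ := by gcongr
  nlinarith

/-- A continuous solution of the estimating equation is as smooth as the data functions, by the
implicit function theorem. -/
theorem contDiffAt_of_estEq_eq_zero {g : ℕ → Param D → Param D} {m : ℕ} (hm : m ≠ 0)
    {θhat : Weight N → Param D} {w : Weight N} {C : ℝ}
    (hg : ∀ n ≤ N, ContDiffAt ℝ m (g n) (θhat w))
    (hsol : ∀ᶠ w' in 𝓝 w, estEq N g (θhat w') w' = 0)
    (hinv : ∀ v, ‖v‖ ≤ C * ‖fderiv ℝ (fun θ => estEq N g θ w) (θhat w) v‖)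
    (hcont : ContinuousAt θhat w) : ContDiffAt ℝ m θhat w := by
  have hm' : ((m : ℕ) : WithTop ℕ∞) ≠ 0 := by exact_mod_cast hm
  have cdf := contDiffAt_estEq hg w
  have hfd : fderiv ℝ (fun v : Weight N × Param D => estEq N g v.2 v.1) (w, θhat w) ∘L
      .inr ℝ (Weight N) (Param D) = fderiv ℝ (fun θ => estEq N g θ w) (θhat w) := by
    have h := (cdf.differentiableAt hm').hasFDerivAt.comp (θhat w)
      (hasFDerivAt_prodMk_right w (θhat w))
    exact h.fderiv.symm
  have if₂ : (fderiv ℝ (fun v : Weight N × Param D => estEq N g v.2 v.1) (w, θhat w) ∘L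
      .inr ℝ (Weight N) (Param D)).IsInvertible := by
    rw [hfd]; exact isInvertible_of_norm_le hinv
  have h1 := cdf.contDiffAt_implicitFunction hm' if₂
  have h2 := cdf.eventually_apply_eq_iff_implicitFunction hm' if₂
  have h3 : Tendsto (fun w' => (w', θhat w')) (𝓝 w) (𝓝 (w, θhat w)) :=
    (continuousAt_id.prodMk hcont)
  refine h1.congr_of_eventuallyEq ?_
  filter_upwards [h3.eventually h2, hsol] with w' hw' hs
  exact (hw'.1 (by simp only [hs, hsol.self_of_nhds])).symm

end EstimatingEquation

/-! ### The expansion on a good sample -/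

section Deterministic

variable {D N : ℕ}

/-- The event on which the expansion is controlled. The data functions and their derivatives are
`O(δ N)` at the reference point `θ₀`, where the estimating function is `O(δ)`; on the whole
parameter domain their derivatives are only required to be a small multiple of `N`. -/
structure GoodSample (K N : ℕ) (Ωθ : Set (Param D)) (A c δ : ℝ) (θ₀ : Param D)
    (g : ℕ → Param D → Param D) : Prop where
  mem : θ₀ ∈ Ωθ
  root : ‖estEq N g θ₀ (ones N)‖ ≤ A * δ
  deriv_root : ∀ n : Fin N, ∀ k ≤ K, ‖iteratedFDeriv ℝ k (g (n + 1)) θ₀‖ ≤ A * δ * N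
  deriv_le : ∀ n : Fin N, ∀ k, 1 ≤ k → k ≤ K + 1 → ∀ θ ∈ Ωθ,
    ‖iteratedFDeriv ℝ k (g (n + 1)) θ‖ ≤ c * N

namespace LooAssumptions

variable {K : ℕ} {Ωθ : Set (Param D)} {ε C : ℝ} {M : ℕ → ℝ}
  {g : ℕ → Param D → Param D} {θhat : Weight N → Param D}

theorem contDiffAt (h : LooAssumptions K N Ωθ ε C M g θhat) (hΩ : IsOpen Ωθ) {n : ℕ} (hn : n ≤ N)
    {θ : Param D} (hθ : θ ∈ Ωθ) : ContDiffAt ℝ ((K + 1 : ℕ) : WithTop ℕ∞) (g n) θ :=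
  (h.diffable n hn).contDiffAt (hΩ.mem_nhds hθ)

theorem contDiffAt_estEq (h : LooAssumptions K N Ωθ ε C M g θhat) (hΩ : IsOpen Ωθ)
    {θ : Param D} (hθ : θ ∈ Ωθ) (w : Weight N) :
    ContDiffAt ℝ ((K + 1 : ℕ) : WithTop ℕ∞) (fun θ' => estEq N g θ' w) θ :=
  contDiffAt_estEq_right (fun _ hn => h.contDiffAt hΩ hn hθ) w

theorem nonneg (h : LooAssumptions K N Ωθ ε C M g θhat) {θ : Param D} (hθ : θ ∈ Ωθ) : 0 ≤ C :=
  (norm_nonneg _).trans (h.convexity θ hθ).2.1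

theorem exists_weightDomain (h : LooAssumptions K N Ωθ ε C M g θhat) (hε : 0 < ε) (n : Fin N) :
    ∃ η > 0, ∀ w ∈ weightDomain (looWeight n) η, θhat w ∈ Ωθ ∧ estEq N g (θhat w) w = 0 := by
  obtain ⟨η, hη, h1, h2⟩ := h.solution n
  refine ⟨η, hη, fun w hw => ⟨h2 ?_, h1 w hw⟩⟩
  exact Metric.self_subset_thickening hε _ (subset_convexHull ℝ _ (Set.mem_image_of_mem _ hw))

theorem expansive (h : LooAssumptions K N Ωθ ε C M g θhat) (hΩ : IsOpen Ωθ) (hΩc : Convex ℝ Ωθ)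
    {a b : Param D} (ha : a ∈ Ωθ) (hb : b ∈ Ωθ) :
    ‖a - b‖ ≤ C * ‖estEq N g a (ones N) - estEq N g b (ones N)‖ :=
  norm_sub_le_of_inner_fderiv (F := fun θ => estEq N g θ (ones N)) hΩc (h.nonneg ha)
    (fun _ hθ => (h.contDiffAt_estEq hΩ hθ _).differentiableAt
      (by exact_mod_cast Nat.succ_ne_zero K))
    (fun θ hθ => (h.convexity θ hθ).2.2) ha hb

/-- The data functions are Lipschitz with the constant of the first derivative. -/
theorem norm_sub_le (h : LooAssumptions K N Ωθ ε C M g θhat) (hΩ : IsOpen Ωθ)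
    (hΩc : Convex ℝ Ωθ) {A c δ : ℝ} {θ₀ : Param D} (hgood : GoodSample K N Ωθ A c δ θ₀ g)
    (n : Fin N) {a b : Param D} (ha : a ∈ Ωθ) (hb : b ∈ Ωθ) :
    ‖g (n + 1) a - g (n + 1) b‖ ≤ c * N * ‖a - b‖ := by
  refine hΩc.norm_image_sub_le_of_norm_fderiv_le (𝕜 := ℝ) (fun θ hθ => ?_) (fun θ hθ => ?_) hb ha
  · exact (h.contDiffAt hΩ n.2 hθ).differentiableAt (by exact_mod_cast Nat.succ_ne_zero K)
  · have := hgood.deriv_le n 1 le_rfl (by omega) θ hθ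
    rwa [← zero_add 1, ← norm_iteratedFDeriv_fderiv, norm_iteratedFDeriv_zero] at this

variable {A c δ : ℝ} {θ₀ : Param D}

/-- Along the segment to a leave-one-out weight the estimating function remains expansive. -/
theorem expansive_segment (h : LooAssumptions K N Ωθ ε C M g θhat) (hΩ : IsOpen Ωθ)
    (hΩc : Convex ℝ Ωθ) (hgood : GoodSample K N Ωθ A c δ θ₀ g) (hCc : C * c ≤ 1 / 2)
    (n : Fin N) {t : ℝ} (ht : |t| ≤ 1) {a b : Param D} (ha : a ∈ Ωθ) (hb : b ∈ Ωθ) :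
    ‖a - b‖ ≤ 2 * C * ‖estEq N g a (ones N + t • (looWeight n - ones N)) -
      estEq N g b (ones N + t • (looWeight n - ones N))‖ := by
  have hN : (0 : ℝ) < N := by exact_mod_cast n.pos
  refine norm_le_two_mul_of_le (h.nonneg ha) hCc (h.expansive hΩ hΩc ha hb)
    (q := t • ((1 / (N : ℝ)) • (g (n + 1) a - g (n + 1) b))) ?_ ?_
  · rw [norm_smul, norm_smul, Real.norm_eq_abs, Real.norm_eq_abs,
      abs_of_pos (a := 1 / (N : ℝ)) (by positivity)]
    calc |t| * (1 / (N : ℝ) * ‖g (n + 1) a - g (n + 1) b‖)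
        ≤ 1 * (1 / (N : ℝ) * (c * N * ‖a - b‖)) := by
          gcongr; exact h.norm_sub_le hΩ hΩc hgood n ha hb
      _ = c * ‖a - b‖ := by field_simp
  · rw [estEq_segment, estEq_segment, smul_sub, smul_sub]
    abel

/-- The infinitesimal version of `expansive_segment`. -/
theorem norm_le_fderiv_segment (h : LooAssumptions K N Ωθ ε C M g θhat) (hΩ : IsOpen Ωθ)
    (hgood : GoodSample K N Ωθ A c δ θ₀ g) (hCc : C * c ≤ 1 / 2)
    (n : Fin N) {t : ℝ} (ht : |t| ≤ 1) {θ : Param D} (hθ : θ ∈ Ωθ) (v : Param D) :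
    ‖v‖ ≤ 2 * C * ‖(fderiv ℝ (fun θ => estEq N g θ (ones N)) θ -
      t • fderiv ℝ (fun θ => (1 / (N : ℝ)) • g (n + 1) θ) θ) v‖ := by
  have hN : (0 : ℝ) < N := by exact_mod_cast n.pos
  have hC := h.nonneg hθ
  have hd : DifferentiableAt ℝ (g (n + 1)) θ :=
    (h.contDiffAt hΩ n.2 hθ).differentiableAt (by exact_mod_cast Nat.succ_ne_zero K)
  refine norm_le_two_mul_of_le hC hCc (norm_le_of_inner_le hC ((h.convexity θ hθ).2.2 v))
    (q := t • ((1 / (N : ℝ)) • fderiv ℝ (g (n + 1)) θ v)) ?_ ?_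
  · rw [norm_smul, norm_smul, Real.norm_eq_abs, Real.norm_eq_abs,
      abs_of_pos (a := 1 / (N : ℝ)) (by positivity)]
    have h1 := hgood.deriv_le n 1 le_rfl (by omega) θ hθ
    rw [← zero_add 1, ← norm_iteratedFDeriv_fderiv, norm_iteratedFDeriv_zero] at h1
    calc |t| * (1 / (N : ℝ) * ‖fderiv ℝ (g (n + 1)) θ v‖)
        ≤ 1 * (1 / (N : ℝ) * (c * N * ‖v‖)) := by
          gcongr
          exact (ContinuousLinearMap.le_opNorm _ _).trans (by gcongr)
      _ = c * ‖v‖ := by field_simp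
  · rw [fderiv_fun_const_smul hd]
    simp

/-- Along the segment to a leave-one-out weight the solution is smooth. -/
theorem contDiffAt_segment (h : LooAssumptions K N Ωθ ε C M g θhat) (hΩ : IsOpen Ωθ)
    (hΩc : Convex ℝ Ωθ) (hε : 0 < ε) (hgood : GoodSample K N Ωθ A c δ θ₀ g)
    (hCc : C * c ≤ 1 / 2) (n : Fin N) {t : ℝ} (ht : t ∈ Set.Icc (0 : ℝ) 1) :
    ContDiffAt ℝ ((K + 1 : ℕ) : WithTop ℕ∞) θhat (ones N + t • (looWeight n - ones N)) := by
  obtain ⟨η, hη, hsol⟩ := h.exists_weightDomain hε n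
  have ht1 : |t| ≤ 1 := by rw [abs_of_nonneg ht.1]; exact ht.2
  have hmem := segment_mem_weightDomain (w := looWeight n) hη ht
  have hev := (isOpen_weightDomain (looWeight n) η).eventually_mem hmem
  have hΩw := (hsol _ hmem).1
  have hC := h.nonneg hΩw
  refine contDiffAt_of_estEq_eq_zero (Nat.succ_ne_zero K) (C := 2 * C)
    (fun m hm => h.contDiffAt hΩ hm hΩw) (hev.mono fun w hw => (hsol w hw).2) (fun v => ?_) ?_
  · have h1 := h.norm_le_fderiv_segment hΩ hgood hCc n ht1 hΩw v
    have hd : DifferentiableAt ℝ (g (n + 1))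
        (θhat (ones N + t • (looWeight n - ones N))) :=
      (h.contDiffAt hΩ n.2 hΩw).differentiableAt (by exact_mod_cast Nat.succ_ne_zero K)
    have hF := (h.contDiffAt_estEq hΩ hΩw (ones N)).differentiableAt
      (by exact_mod_cast Nat.succ_ne_zero K)
    have h2 := (hF.hasFDerivAt.sub ((hd.const_smul (1 / (N : ℝ))).hasFDerivAt.const_smul t)).fderiv
    have h3 : (fun θ => estEq N g θ (ones N + t • (looWeight n - ones N))) =
        ((fun θ => estEq N g θ (ones N)) - t • (1 / (N : ℝ)) • g (n + 1)) := by
      ext1 θ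
      exact estEq_segment g θ n t
    rw [h3, h2]
    exact h1
  · exact continuousAt_of_estEq_eq_zero (by have := n.pos; omega) (by positivity)
      (hev.mono fun w hw => hsol w hw)
      (fun θ hθ => h.expansive_segment hΩ hΩc hgood hCc n ht1 hθ hΩw)
      (fun i θ hθ => h.norm_sub_le hΩ hΩc hgood i hθ hΩw)

end LooAssumptions

/-- The deterministic expansion: on a good sample the solution is smooth and the leave-one-out
error of the jackknife of order `K` is `O(δ ^ (K + 1))`, with a constant that depends neither on
`N` nor on the data. -/
theorem exists_hoijError_le (K : ℕ) {Ωθ : Set (Param D)} (hΩ : IsOpen Ωθ) (hΩc : Convex ℝ Ωθ)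
    {ε : ℝ} (hε : 0 < ε) (C A c : ℝ) (hC : 0 ≤ C) (hCc : C * c ≤ 1 / 2) (hc : 0 ≤ c)
    (hcA : c ≤ A) :
    ∃ R : ℝ, ∀ (N : ℕ) (δ : ℝ) (M : ℕ → ℝ) (g : ℕ → Param D → Param D)
      (θhat : Weight N → Param D) (θ₀ : Param D), 1 ≤ N → 0 ≤ δ → δ ≤ 1 →
      LooAssumptions K N Ωθ ε C M g θhat → GoodSample K N Ωθ A c δ θ₀ g →
      (∀ k, 1 ≤ k → k ≤ K + 1 → ∀ θ ∈ Ωθ,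
        ‖iteratedFDeriv ℝ k (fun θ' => estEq N g θ' (ones N)) θ‖ ≤ A) →
      ContDiffAt ℝ (K : WithTop ℕ∞) θhat (ones N) ∧
      ∀ n : Fin N, hoijError K θhat (looWeight n) ≤ R * δ ^ (K + 1) := by
  have hA : 0 ≤ A := hc.trans hcA
  obtain ⟨R, hR, hcurve⟩ := exists_norm_iteratedFDeriv_curve_le (E := Param D) (G := Param D) K
    (2 * C) (3 * A) (by positivity) (by positivity)
  refine ⟨R, fun N δ M g θhat θ₀ hN hδ hδ1 h hgood hFb => ?_⟩
  have hKK : ((K : ℕ) : WithTop ℕ∞) ≤ ((K + 1 : ℕ) : WithTop ℕ∞) := by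
    exact_mod_cast Nat.le_succ K
  have hN' : (0 : ℝ) < N := by exact_mod_cast hN
  have hsm : ∀ n : Fin N, ContDiffAt ℝ ((K + 1 : ℕ) : WithTop ℕ∞) θhat (ones N) := by
    intro n
    simpa using h.contDiffAt_segment hΩ hΩc hε hgood hCc n (t := 0) (by simp)
  refine ⟨(hsm ⟨0, hN⟩).of_le hKK, fun n => ?_⟩
  obtain ⟨η, hη, hsol⟩ := h.exists_weightDomain hε n
  set w : ℝ → Weight N := fun t => ones N + t • (looWeight n - ones N) with hw
  have hwc : ContDiff ℝ ((K + 1 : ℕ) : WithTop ℕ∞) w :=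
    contDiff_const.add (contDiff_id.smul contDiff_const)
  set u : Param D → Param D := fun θ => (1 / (N : ℝ)) • g (n + 1) θ with hu
  have hud : ∀ θ ∈ Ωθ, ContDiffAt ℝ ((K + 1 : ℕ) : WithTop ℕ∞) u θ := fun θ hθ =>
    ContDiffAt.const_smul _ (h.contDiffAt hΩ n.2 hθ)
  have hun : ∀ θ ∈ Ωθ, ∀ k ≤ K + 1,
      ‖iteratedFDeriv ℝ k u θ‖ = 1 / (N : ℝ) * ‖iteratedFDeriv ℝ k (g (n + 1)) θ‖ := by
    intro θ hθ k hk
    rw [hu, iteratedFDeriv_const_smul_apply'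
      ((h.contDiffAt hΩ n.2 hθ).of_le (by exact_mod_cast hk)), norm_smul, Real.norm_eq_abs,
      abs_of_pos (by positivity)]
  have hu0 : ∀ k ≤ K, ‖iteratedFDeriv ℝ k u θ₀‖ ≤ A * δ := by
    intro k hk
    rw [hun _ hgood.mem k (by omega)]
    calc _ ≤ 1 / (N : ℝ) * (A * δ * N) := by gcongr; exact hgood.deriv_root n k hk
      _ = A * δ := by field_simp
  have hub : ∀ k, 1 ≤ k → k ≤ K + 1 → ∀ θ ∈ Ωθ, ‖iteratedFDeriv ℝ k u θ‖ ≤ c := by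
    intro k h1 hk θ hθ
    rw [hun _ hθ k hk]
    calc _ ≤ 1 / (N : ℝ) * (c * N) := by gcongr; exact hgood.deriv_le n k h1 hk θ hθ
      _ = c := by field_simp
  have hlip : ∀ k ≤ K, ∀ θ ∈ Ωθ, ‖iteratedFDeriv ℝ k u θ‖ ≤ A * δ + c * ‖θ - θ₀‖ := by
    intro k hk θ hθ
    have h1 := norm_iteratedFDeriv_sub_le hΩc (k := k)
      (fun θ hθ => (hud θ hθ).of_le (by exact_mod_cast Nat.succ_le_succ hk))
      (hub (k + 1) (by omega) (by omega)) hθ hgood.mem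
    calc ‖iteratedFDeriv ℝ k u θ‖ = ‖iteratedFDeriv ℝ k u θ₀ +
          (iteratedFDeriv ℝ k u θ - iteratedFDeriv ℝ k u θ₀)‖ := by rw [add_sub_cancel]
      _ ≤ _ := (norm_add_le _ _).trans (add_le_add (hu0 k hk) h1)
  have hmem : ∀ t ∈ Set.Icc (0 : ℝ) 1, w t ∈ weightDomain (looWeight n) η := fun t ht =>
    segment_mem_weightDomain hη ht
  -- the solutions on the segment are as close to `θ₀` as the root at `1_N`
  have hnear : ∀ t ∈ Set.Icc (0 : ℝ) 1, ‖θhat (w t) - θ₀‖ ≤ 4 * C * A * δ := by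
    intro t ht
    obtain ⟨hm, h0⟩ := hsol _ (hmem t ht)
    rw [estEq_segment, sub_eq_zero] at h0
    have h1 := h.expansive hΩ hΩc hm hgood.mem
    have h2 := hlip 0 (by omega) _ hm
    rw [norm_iteratedFDeriv_zero] at h2
    have h3 : ‖estEq N g (θhat (w t)) (ones N) - estEq N g θ₀ (ones N)‖ ≤
        (A * δ + c * ‖θhat (w t) - θ₀‖) + A * δ := by
      refine (_root_.norm_sub_le _ _).trans (add_le_add ?_ hgood.root)
      rw [h0, norm_smul, Real.norm_eq_abs, abs_of_nonneg ht.1]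
      calc _ ≤ 1 * ‖u (θhat (w t))‖ := by gcongr; exact ht.2
        _ ≤ _ := by rw [one_mul]; exact h2
    have h4 : C * ‖estEq N g (θhat (w t)) (ones N) - estEq N g θ₀ (ones N)‖ ≤
        C * ((A * δ + c * ‖θhat (w t) - θ₀‖) + A * δ) := by gcongr
    have h5 : C * c * ‖θhat (w t) - θ₀‖ ≤ 1 / 2 * ‖θhat (w t) - θ₀‖ := by gcongr
    nlinarith
  have hθc : ∀ t ∈ Set.Icc (0 : ℝ) 1,
      ContDiffAt ℝ ((K + 1 : ℕ) : WithTop ℕ∞) (fun t => θhat (w t)) t := fun t ht =>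
    (h.contDiffAt_segment hΩ hΩc hε hgood hCc n ht).comp t hwc.contDiffAt
  have hder : ∀ t ∈ Set.Icc (0 : ℝ) 1,
      ‖iteratedFDeriv ℝ (K + 1) (fun t => θhat (w t)) t‖ ≤ R * δ ^ (K + 1) := by
    intro t ht
    have ht1 : |t| ≤ 1 := by rw [abs_of_nonneg ht.1]; exact ht.2
    have hm := (hsol _ (hmem t ht)).1
    refine hcurve δ t (fun θ => estEq N g θ (ones N)) u (fun t => θhat (w t)) hδ hδ1 ht1
      (h.contDiffAt_estEq hΩ hm _) (hud _ hm) (hθc t ht) ?_ ?_ ?_ ?_ ?_ (K + 1) (by omega) le_rfl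
    · have hev := hwc.continuous.continuousAt.eventually
        ((isOpen_weightDomain (looWeight n) η).eventually_mem (hmem t ht))
      filter_upwards [hev] with s hs
      have h0 := (hsol _ hs).2
      rwa [estEq_segment, sub_eq_zero] at h0
    · intro j h1 hj
      exact (hFb j h1 hj _ hm).trans (by linarith)
    · intro j hj
      refine (hlip j hj _ hm).trans ?_
      have h1 : c * ‖θhat (w t) - θ₀‖ ≤ c * (4 * C * A * δ) := by
        gcongr; exact hnear t ht
      have h2 : C * c * (A * δ) ≤ 1 / 2 * (A * δ) := by gcongr
      nlinarith
    · exact (hub _ (by omega) le_rfl _ hm).trans (by linarith)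
    · exact h.norm_le_fderiv_segment hΩ hgood hCc n ht1 hm
  have htay := norm_taylor_unit_le hθc hder
  have hw0 : w 0 = ones N := by simp [hw]
  have hw1 : w 1 = looWeight n := by simp [hw]
  rw [hw0, hw1] at htay
  have hsum : ∑ k ∈ Finset.Icc 1 K, (1 / (k.factorial : ℝ)) • dirDeriv k θhat (looWeight n) =
      ∑ k ∈ Finset.Icc 1 K, (1 / (k.factorial : ℝ)) • iteratedDeriv k (fun t => θhat (w t)) 0 := by
    refine Finset.sum_congr rfl fun k hk => ?_
    have hk' : k ≤ K + 1 := (Finset.mem_Icc.1 hk).2.trans (Nat.le_succ K)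
    rw [dirDeriv, iteratedFDeriv_apply_const_eq_iteratedDeriv
      ((hsm n).of_le (by exact_mod_cast hk'))]
  rw [hoijError, hoij, hsum]
  exact htay

end Deterministic

/-! ### Arrays of partial derivatives and operator norms -/

section ArrayNorm

variable {D : ℕ}

theorem arrayNorm_nonneg {k : ℕ} (a : DerivArray D k) : 0 ≤ arrayNorm a := Real.sqrt_nonneg _

theorem norm_toLp_le_arrayNorm {k : ℕ} (a : DerivArray D k) (idx : Fin k → Fin D) :
    ‖(WithLp.toLp 2 (a idx) : Param D)‖ ≤ arrayNorm a := by
  rw [EuclideanSpace.norm_eq, arrayNorm]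
  refine Real.sqrt_le_sqrt ?_
  simp only [Real.norm_eq_abs, sq_abs]
  exact Finset.single_le_sum (f := fun idx => ∑ d, a idx d ^ 2)
    (fun _ _ => Finset.sum_nonneg fun _ _ => sq_nonneg _) (Finset.mem_univ idx)

/-- A multilinear map is controlled by its values on the standard basis. -/
theorem norm_iteratedFDeriv_le_arrayNorm (k : ℕ) (f : Param D → Param D) (θ : Param D) :
    ‖iteratedFDeriv ℝ k f θ‖ ≤ Fintype.card (Fin k → Fin D) * arrayNorm (derivArray k f θ) := by
  set T := iteratedFDeriv ℝ k f θ with hT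
  refine T.opNorm_le_bound (mul_nonneg (by positivity) (arrayNorm_nonneg _)) fun v => ?_
  have hv : v = fun i => ∑ j, v i j • EuclideanSpace.single j (1 : ℝ) := by
    funext i
    ext d
    simp [Finset.sum_apply, Pi.single_apply]
  have hexp : T v = ∑ idx : Fin k → Fin D,
      (∏ i, v i (idx i)) • T fun i => EuclideanSpace.single (idx i) (1 : ℝ) := by
    conv_lhs => rw [hv, T.map_sum]
    exact Finset.sum_congr rfl fun idx _ => T.map_smul_univ _ _
  rw [hexp]
  calc _ ≤ ∑ _idx : Fin k → Fin D, arrayNorm (derivArray k f θ) * ∏ i, ‖v i‖ := by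
        refine norm_sum_le_of_le _ fun idx _ => ?_
        rw [norm_smul, mul_comm, norm_prod]
        refine mul_le_mul (norm_toLp_le_arrayNorm (derivArray k f θ) idx) ?_ (by positivity)
          (arrayNorm_nonneg _)
        exact Finset.prod_le_prod (fun _ _ => norm_nonneg _) fun i _ =>
          PiLp.norm_apply_le (v i) (idx i)
    _ = _ := by simp [mul_assoc]

theorem arrayNorm_le_norm_iteratedFDeriv (k : ℕ) (f : Param D → Param D) (θ : Param D) :
    arrayNorm (derivArray k f θ) ≤
      (Fintype.card (Fin k → Fin D) * D : ℝ) * ‖iteratedFDeriv ℝ k f θ‖ := by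
  have hle : ∀ idx d, |derivArray k f θ idx d| ≤ ‖iteratedFDeriv ℝ k f θ‖ := by
    intro idx d
    refine (PiLp.norm_apply_le (iteratedFDeriv ℝ k f θ _) d).trans ?_
    refine (ContinuousMultilinearMap.le_opNorm _ _).trans ?_
    simp
  rw [arrayNorm]
  refine Real.sqrt_le_iff.2 ⟨by positivity, ?_⟩
  calc ∑ idx, ∑ d, derivArray k f θ idx d ^ 2
      ≤ ∑ _idx : Fin k → Fin D, ∑ _d : Fin D, ‖iteratedFDeriv ℝ k f θ‖ ^ 2 := by
        refine Finset.sum_le_sum fun idx _ => Finset.sum_le_sum fun d _ => ?_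
        exact sq_le_sq' (neg_le_of_abs_le (hle idx d)) (le_of_abs_le (hle idx d))
    _ = (Fintype.card (Fin k → Fin D) * D : ℕ) * ‖iteratedFDeriv ℝ k f θ‖ ^ 2 := by
        simp [mul_assoc]
    _ ≤ ((Fintype.card (Fin k → Fin D) * D : ℕ) : ℝ) ^ 2 * ‖iteratedFDeriv ℝ k f θ‖ ^ 2 := by
        gcongr
        exact_mod_cast Nat.le_self_pow two_ne_zero _
    _ = _ := by push_cast; ring

theorem measurable_arrayNorm {k : ℕ} : Measurable (arrayNorm : DerivArray D k → ℝ) := by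
  unfold arrayNorm
  fun_prop

/-- The array of order zero lists the coordinates of the value. -/
theorem toLp_derivArray_zero (f : Param D → Param D) (θ : Param D) (idx : Fin 0 → Fin D) :
    (WithLp.toLp 2 (derivArray 0 f θ idx) : Param D) = f θ := by
  ext d
  simp [derivArray]

end ArrayNorm

/-! ### Maxima of independent identically distributed sequences -/

section Maxima

/-- The terms of a convergent antitone series are `o(1 / n)`. -/
theorem tendsto_mul_of_antitone_of_tsum_ne_top {a : ℕ → ENNReal} (ha : Antitone a)
    (hs : ∑' n, a n ≠ ⊤) : Tendsto (fun n : ℕ => (n : ENNReal) * a n) atTop (𝓝 0) := by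
  have htail := ENNReal.tendsto_sum_nat_add a hs
  have ha0 : Tendsto a atTop (𝓝 0) := ENNReal.tendsto_atTop_zero_of_tsum_ne_top hs
  have hhalf : Tendsto (fun n : ℕ => n / 2) atTop atTop :=
    Nat.tendsto_div_const_atTop two_ne_zero
  have hlim : Tendsto (fun n : ℕ => 2 * (∑' k, a (k + n / 2)) + a n) atTop (𝓝 0) := by
    have := (ENNReal.Tendsto.const_mul (htail.comp hhalf)
      (Or.inr (ENNReal.ofNat_ne_top (n := 2)))).add ha0
    simpa using this
  refine tendsto_of_tendsto_of_tendsto_of_le_of_le tendsto_const_nhds hlim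
    (fun _ => zero_le) fun n => ?_
  have h1 : ((n / 2 : ℕ) : ENNReal) * a n ≤ ∑' k, a (k + n / 2) := by
    calc ((n / 2 : ℕ) : ENNReal) * a n = ∑ _k ∈ Finset.range (n / 2), a n := by simp
      _ ≤ ∑ k ∈ Finset.range (n / 2), a (k + n / 2) := by
        refine Finset.sum_le_sum fun k hk => ha ?_
        have := Finset.mem_range.1 hk
        omega
      _ ≤ _ := ENNReal.sum_le_tsum _
  calc (n : ENNReal) * a n ≤ ((2 * (n / 2) + 1 : ℕ) : ENNReal) * a n := by
        gcongr
        omega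
    _ = 2 * (((n / 2 : ℕ) : ENNReal) * a n) + a n := by push_cast; ring
    _ ≤ _ := by gcongr

variable {Ω : Type*} [MeasurableSpace Ω] {μ : Measure Ω}

/-- By the second Borel–Cantelli lemma, an independent identically distributed sequence that
almost surely grows at most linearly has `∑ P(X > b n) < ∞`, that is a finite first moment. -/
theorem tsum_measure_lt_ne_top_of_ae_eventually_le {X : ℕ → Ω → ENNReal} (hX : iIndepFun X μ)
    (hid : ∀ n, IdentDistrib (X n) (X 0) μ μ) {r : ℕ → ENNReal}
    (hbd : ∀ᵐ ω ∂μ, ∀ᶠ n in atTop, X n ω ≤ r n) :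
    ∑' n : ℕ, μ {ω | r n < X 0 ω} ≠ ⊤ := by
  have : IsProbabilityMeasure μ := hX.isProbabilityMeasure
  set X' : ℕ → Ω → ENNReal := fun n => (hid n).aemeasurable_fst.mk (X n) with hX'
  have hae : ∀ n, X n =ᵐ[μ] X' n := fun n => (hid n).aemeasurable_fst.ae_eq_mk
  have hm : ∀ n, Measurable (X' n) := fun n => (hid n).aemeasurable_fst.measurable_mk
  have hind : iIndepFun X' μ := (iIndepFun_congr hae).1 hX
  set s : ℕ → Set Ω := fun n => X' n ⁻¹' Set.Ioi (r n) with hs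
  have hsm : ∀ n, MeasurableSet (s n) := fun n => hm n measurableSet_Ioi
  have hsi : iIndepSet s μ := by
    rw [iIndepSet_iff_meas_biInter hsm]
    intro S
    exact (iIndepFun_iff_measure_inter_preimage_eq_mul.1 hind) S
      (fun _ _ => measurableSet_Ioi)
  have hp : ∀ n, μ (s n) = μ {ω | r n < X 0 ω} := by
    intro n
    have h1 := (hid n).measure_mem_eq (s := Set.Ioi (r n)) measurableSet_Ioi
    refine Eq.trans (measure_congr ?_) h1
    filter_upwards [hae n] with ω hω
    exact congrArg (fun z => r n < z) hω.symm
  intro htop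
  have h1 := measure_limsup_eq_one hsm hsi (by simpa only [hp] using htop)
  have h0 : μ (limsup s atTop) = 0 := by
    refine measure_mono_null (t := {ω | ¬ ((∀ᶠ n in atTop, X n ω ≤ r n) ∧
      ∀ n, X n ω = X' n ω)}) ?_ (ae_iff.1 (hbd.and (ae_all_iff.2 hae)))
    intro ω hω hc
    rw [mem_limsup_iff_frequently_mem] at hω
    refine hω (hc.1.mono fun n hn => ?_)
    simp only [hs, Set.mem_preimage, Set.mem_Ioi, not_lt]
    rw [← hc.2 n]
    exact hn
  rw [h0] at h1
  exact zero_ne_one h1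

/-- The maximum of the first `N` members of an independent identically distributed sequence that
almost surely grows at most linearly is `o(N)` in probability. -/
theorem tendsto_measure_exists_lt_of_ae_eventually_le {X : ℕ → Ω → ENNReal}
    (hX : iIndepFun X μ) (hid : ∀ n, IdentDistrib (X n) (X 0) μ μ) {b c : ℝ} (hb : 0 < b)
    (hc : 0 < c) (hbd : ∀ᵐ ω ∂μ, ∀ᶠ n : ℕ in atTop, X n ω ≤ ENNReal.ofReal (b * n)) :
    Tendsto (fun N : ℕ => μ {ω | ∃ n < N, ENNReal.ofReal (c * N) < X n ω}) atTop (𝓝 0) := by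
  have hsum := tsum_measure_lt_ne_top_of_ae_eventually_le hX hid hbd
  set a : ℕ → ENNReal := fun n => μ {ω | ENNReal.ofReal (b * n) < X 0 ω} with ha
  have hanti : Antitone a := by
    intro m n hmn
    exact measure_mono fun ω (hω : _ < _) => show _ < _ from
      (ENNReal.ofReal_le_ofReal (by gcongr)).trans_lt hω
  have hna := tendsto_mul_of_antitone_of_tsum_ne_top hanti hsum
  have ha0 : Tendsto a atTop (𝓝 0) := ENNReal.tendsto_atTop_zero_of_tsum_ne_top hsum
  set m : ℕ → ℕ := fun N => ⌊c / b * N⌋₊ with hm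
  have hmt : Tendsto m atTop atTop :=
    tendsto_nat_floor_atTop.comp
      (tendsto_natCast_atTop_atTop.const_mul_atTop (by positivity))
  have hlim : Tendsto (fun N => ENNReal.ofReal (b / c) * ((m N : ENNReal) * a (m N) + a (m N)))
      atTop (𝓝 0) := by
    have := ENNReal.Tendsto.const_mul ((hna.comp hmt).add (ha0.comp hmt))
      (Or.inr (ENNReal.ofReal_ne_top (r := b / c)))
    simpa using this
  refine tendsto_of_tendsto_of_tendsto_of_le_of_le tendsto_const_nhds hlim
    (fun _ => zero_le) fun N => ?_
  have hset : {ω | ∃ n < N, ENNReal.ofReal (c * N) < X n ω} =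
      ⋃ n ∈ Finset.range N, {ω | ENNReal.ofReal (c * N) < X n ω} := by
    ext ω; simp
  have hbm : b * m N ≤ c * N := by
    have := Nat.floor_le (a := c / b * N) (by positivity)
    calc b * m N ≤ b * (c / b * N) := by gcongr
      _ = c * N := by field_simp
  have hNm : (N : ℝ) ≤ b / c * (m N + 1) := by
    have := (Nat.lt_floor_add_one (c / b * (N : ℝ))).le
    calc (N : ℝ) = b / c * (c / b * N) := by field_simp
      _ ≤ b / c * (m N + 1) := by gcongr
  calc μ {ω | ∃ n < N, ENNReal.ofReal (c * N) < X n ω}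
      ≤ ∑ n ∈ Finset.range N, μ {ω | ENNReal.ofReal (c * N) < X n ω} := by
        rw [hset]; exact measure_biUnion_finset_le _ _
    _ ≤ ∑ _n ∈ Finset.range N, a (m N) := by
        refine Finset.sum_le_sum fun n _ => ?_
        have h1 := (hid n).measure_mem_eq (s := Set.Ioi (ENNReal.ofReal (c * N)))
          measurableSet_Ioi
        change μ (X n ⁻¹' Set.Ioi (ENNReal.ofReal (c * N))) ≤ _
        rw [h1]
        exact measure_mono fun ω (hω : _ < _) => show _ < _ from
          (ENNReal.ofReal_le_ofReal hbm).trans_lt hω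
    _ = ENNReal.ofReal N * a (m N) := by simp
    _ ≤ ENNReal.ofReal (b / c * (m N + 1)) * a (m N) := by gcongr
    _ = _ := by
        rw [ENNReal.ofReal_mul (by positivity), ENNReal.ofReal_add (by positivity) zero_le_one]
        simp only [ENNReal.ofReal_natCast, ENNReal.ofReal_one]
        ring

end Maxima

/-! ### Means, and a root of the limiting estimating function -/

section Mean

theorem le_of_continuous_of_dense {X : Type*} [TopologicalSpace X] {s : Set X} (hs : Dense s)
    {φ : X → ℝ} (hφ : Continuous φ) {B : ℝ} (h : ∀ q ∈ s, φ q ≤ B) (x : X) : φ x ≤ B := by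
  have hall : closure s ⊆ {q : X | φ q ≤ B} :=
    (isClosed_le hφ continuous_const).closure_subset_iff.2 h
  rw [hs.closure_eq] at hall
  exact hall (Set.mem_univ x)

variable {D K N : ℕ}

theorem estEq_ones (g : ℕ → Param D → Param D) (θ : Param D) :
    estEq N g θ (ones N) = (N : ℝ)⁻¹ • (g 0 θ + ∑ i ∈ Finset.range N, g (i + 1) θ) := by
  simp [estEq, ones, Finset.sum_range]

theorem arrayNorm_derivArray_zero (f : Param D → Param D) (θ : Param D) :
    arrayNorm (derivArray 0 f θ) = ‖f θ‖ := by
  rw [arrayNorm, EuclideanSpace.norm_eq, Fintype.sum_unique]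
  simp [derivArray]

theorem LooAssumptions.norm_iteratedFDeriv_estEq_le {Ωθ : Set (Param D)} {ε C : ℝ} {M : ℕ → ℝ}
    {g : ℕ → Param D → Param D} {θhat : Weight N → Param D}
    (h : LooAssumptions K N Ωθ ε C M g θhat) {k : ℕ} (h1 : 1 ≤ k) (hk : k ≤ K + 1)
    {θ : Param D} (hθ : θ ∈ Ωθ) :
    ‖iteratedFDeriv ℝ k (fun θ' => estEq N g θ' (ones N)) θ‖ ≤
      Fintype.card (Fin k → Fin D) * |M k| :=
  (norm_iteratedFDeriv_le_arrayNorm k _ θ).trans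
    (by gcongr; exact (h.bounded k h1 hk θ hθ).trans (le_abs_self _))

theorem LooAssumptions.norm_estEq_sub_le {Ωθ : Set (Param D)} {ε C : ℝ} {M : ℕ → ℝ}
    {g : ℕ → Param D → Param D} {θhat : Weight N → Param D}
    (h : LooAssumptions K N Ωθ ε C M g θhat) (hΩ : IsOpen Ωθ) (hΩc : Convex ℝ Ωθ)
    {a b : Param D} (ha : a ∈ Ωθ) (hb : b ∈ Ωθ) :
    ‖estEq N g a (ones N) - estEq N g b (ones N)‖ ≤
      (Fintype.card (Fin 1 → Fin D) * |M 1|) * ‖a - b‖ := by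
  refine hΩc.norm_image_sub_le_of_norm_fderiv_le (𝕜 := ℝ)
    (f := fun θ => estEq N g θ (ones N)) (fun θ hθ => ?_) (fun θ hθ => ?_) hb ha
  · exact (h.contDiffAt_estEq hΩ hθ _).differentiableAt (by exact_mod_cast Nat.succ_ne_zero K)
  · have := h.norm_iteratedFDeriv_estEq_le le_rfl (by omega) hθ
    rwa [← norm_iteratedFDeriv_zero (𝕜 := ℝ) (f := fderiv ℝ _), norm_iteratedFDeriv_fderiv]

variable {Ω : Type*} [MeasurableSpace Ω] {μ : Measure Ω} {Ωθ : Set (Param D)}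
  {g : ℕ → Ω → Param D → Param D}

namespace IIDDerivs

/-- The value at a point as a measurable function of the random array of order zero. -/
theorem exists_measurable_eval {θ : Param D} (hθ : θ ∈ Ωθ) :
    ∃ φ : (Ωθ → DerivArray D 0) → Param D, Measurable φ ∧
      ∀ f : Param D → Param D, φ (fun θ' => derivArray 0 f θ') = f θ := by
  refine ⟨fun y => WithLp.toLp 2 (y ⟨θ, hθ⟩ default), ?_, fun f => toLp_derivArray_zero f θ _⟩
  refine (PiLp.continuous_toLp 2 _).measurable.comp ?_
  exact (measurable_pi_apply _).comp (measurable_pi_apply _)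

theorem iIndepFun_apply (h : IIDDerivs μ K Ωθ g) {θ : Param D} (hθ : θ ∈ Ωθ) :
    iIndepFun (fun n ω => g (n + 1) ω θ) μ := by
  obtain ⟨φ, hφ, hφg⟩ := exists_measurable_eval hθ
  convert (h.indep 0 (by omega)).comp (fun _ => φ) (fun _ => hφ) using 1
  funext n ω
  exact (hφg _).symm

theorem identDistrib_apply (h : IIDDerivs μ K Ωθ g) {θ : Param D} (hθ : θ ∈ Ωθ) (n : ℕ) :
    IdentDistrib (fun ω => g (n + 1) ω θ) (fun ω => g 1 ω θ) μ μ := by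
  obtain ⟨φ, hφ, hφg⟩ := exists_measurable_eval hθ
  convert (h.identDistrib 0 (by omega) n).comp hφ using 1
  · funext ω; exact (hφg _).symm
  · funext ω; exact (hφg _).symm

theorem memLp_apply (h : IIDDerivs μ K Ωθ g) {θ : Param D} (hθ : θ ∈ Ωθ) (n : ℕ) :
    MemLp (fun ω => g (n + 1) ω θ) 2 μ := by
  rw [memLp_two_iff_integrable_sq_norm
    (h.identDistrib_apply hθ n).aemeasurable_fst.aestronglyMeasurable]
  simpa only [arrayNorm_derivArray_zero] using h.secondMoment 0 (by omega) n θ hθ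

/-- The law of large numbers for the estimating function at a point. -/
theorem ae_tendsto_estEq [IsProbabilityMeasure μ] (h : IIDDerivs μ K Ωθ g) {θ : Param D}
    (hθ : θ ∈ Ωθ) :
    ∀ᵐ ω ∂μ, Tendsto (fun N => estEq N (fun n => g n ω) θ (ones N)) atTop
      (𝓝 (∫ ω, g 1 ω θ ∂μ)) := by
  have hsl := strong_law_ae (μ := μ) (fun n ω => g (n + 1) ω θ)
    ((h.memLp_apply hθ 0).integrable (by norm_num))
    (fun i j hij => (h.iIndepFun_apply hθ).indepFun hij)
    (fun n => h.identDistrib_apply hθ n)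
  filter_upwards [hsl] with ω hω
  have h0 : Tendsto (fun N : ℕ => (N : ℝ)⁻¹ • g 0 ω θ) atTop (𝓝 0) := by
    simpa using (tendsto_inv_atTop_nhds_zero_nat (𝕜 := ℝ)).smul_const (g 0 ω θ)
  have := h0.add hω
  simp only [zero_add] at this
  refine this.congr fun N => ?_
  rw [estEq_ones, smul_add]

/-- The limiting estimating function has a root in the parameter domain: every limit point of the
solutions `θhat N ω 1_N` is one. -/
theorem exists_root [IsProbabilityMeasure μ] (h : IIDDerivs μ K Ωθ g)
    (hΩ : IsOpen Ωθ) (hΩc : Convex ℝ Ωθ)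
    {θhat : (N : ℕ) → Ω → Weight N → Param D} {ε C : ℝ} (hε : 0 < ε) {M : ℕ → ℝ} {N₀ : Ω → ℕ}
    (hassu : ∀ᵐ ω ∂μ, ∀ N, N₀ ω ≤ N →
      LooAssumptions K N Ωθ ε C M (fun n => g n ω) (θhat N ω)) :
    ∃ θ₀ ∈ Ωθ, ∫ ω, g 1 ω θ₀ ∂μ = 0 := by
  set L : ℝ := Fintype.card (Fin 1 → Fin D) * |M 1| with hL
  have hL0 : 0 ≤ L := by positivity
  set m : Param D → Param D := fun θ => ∫ ω, g 1 ω θ ∂μ with hm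
  have hmlip : ∀ a ∈ Ωθ, ∀ b ∈ Ωθ, ‖m a - m b‖ ≤ L * ‖a - b‖ := by
    intro a ha b hb
    obtain ⟨ω, hω, h1, h2⟩ :=
      (hassu.and ((h.ae_tendsto_estEq ha).and (h.ae_tendsto_estEq hb))).exists
    refine le_of_tendsto (h1.sub h2).norm ?_
    filter_upwards [eventually_ge_atTop (N₀ ω)] with N hN
    exact (hω N hN).norm_estEq_sub_le hΩ hΩc ha hb
  obtain ⟨s, hsc, hsd⟩ := TopologicalSpace.exists_countable_dense Ωθ
  have hs_ae : ∀ᵐ ω ∂μ, ∀ q ∈ s, Tendsto (fun N => estEq N (fun n => g n ω) q (ones N)) atTop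
      (𝓝 (m q)) := (ae_ball_iff hsc).2 fun q _ => h.ae_tendsto_estEq q.2
  obtain ⟨ω, hω, hq⟩ := (hassu.and hs_ae).exists
  set x : ℕ → Param D := fun N => θhat N ω (ones N) with hx
  have hxN : ∀ᶠ N in atTop, LooAssumptions K N Ωθ ε C M (fun n => g n ω) (θhat N ω) ∧
      x N ∈ Ωθ ∧ estEq N (fun n => g n ω) (x N) (ones N) = 0 ∧ Metric.ball (x N) ε ⊆ Ωθ := by
    filter_upwards [eventually_ge_atTop (N₀ ω), eventually_ge_atTop 1] with N hN hN1
    have hloo := hω N hN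
    obtain ⟨η, hη, h1, h2⟩ := hloo.solution ⟨0, hN1⟩
    have hones : ones N ∈ weightDomain (looWeight ⟨0, hN1⟩) η := by
      simpa using segment_mem_weightDomain (w := looWeight (⟨0, hN1⟩ : Fin N)) hη (t := 0)
        (by simp)
    have hball : Metric.ball (x N) ε ⊆ Ωθ := by
      refine Set.Subset.trans ?_ h2
      exact Metric.ball_subset_thickening
        (subset_convexHull ℝ _ (Set.mem_image_of_mem _ hones)) ε
    exact ⟨hloo, hball (Metric.mem_ball_self hε), h1 _ hones, hball⟩
  obtain ⟨q₀, hq₀⟩ : s.Nonempty := by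
    obtain ⟨N, hN⟩ := hxN.exists
    have : Nonempty Ωθ := ⟨⟨x N, hN.2.1⟩⟩
    exact hsd.nonempty
  -- strong monotonicity keeps the solutions in a bounded set
  have hbdd : ∀ᶠ N in atTop, x N ∈ Metric.closedBall (q₀ : Param D) (C * (‖m q₀‖ + 1)) := by
    filter_upwards [hxN, (hq q₀ hq₀).norm.eventually_lt_const (lt_add_one _)] with N hN hlt
    have h1 := hN.1.expansive hΩ hΩc q₀.2 hN.2.1
    rw [hN.2.2.1, sub_zero] at h1
    rw [mem_closedBall_iff_norm']
    refine h1.trans ?_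
    have := hN.1.nonneg hN.2.1
    gcongr
  obtain ⟨θ₀, -, φ, hφ, hlim⟩ :=
    tendsto_subseq_of_frequently_bounded Metric.isBounded_closedBall hbdd.frequently
  have hφN := hφ.tendsto_atTop.eventually hxN
  have hmem : θ₀ ∈ Ωθ := by
    obtain ⟨n, hn, hd⟩ := (hφN.and (hlim.eventually (Metric.ball_mem_nhds θ₀ hε))).exists
    exact hn.2.2.2 (Metric.mem_ball_comm.1 hd)
  refine ⟨θ₀, hmem, ?_⟩
  have hmq : ∀ q ∈ s, ‖m q‖ ≤ L * ‖(q : Param D) - θ₀‖ := by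
    intro q hqs
    refine le_of_tendsto_of_tendsto ((hq q hqs).norm.comp hφ.tendsto_atTop)
      ((hlim.const_sub (q : Param D)).norm.const_mul L) ?_
    filter_upwards [hφN] with n hn
    have := hn.1.norm_estEq_sub_le hΩ hΩc q.2 hn.2.1
    rwa [hn.2.2.1, sub_zero] at this
  have hbound : ∀ q ∈ s, ‖m θ₀‖ - 2 * L * ‖(q : Param D) - θ₀‖ ≤ 0 := by
    intro q hqs
    have h1 := hmq q hqs
    have h2 := hmlip θ₀ hmem q q.2
    have h3 : ‖m θ₀‖ ≤ ‖m θ₀ - m q‖ + ‖m q‖ := by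
      simpa using norm_add_le (m θ₀ - m q) (m q)
    rw [norm_sub_rev θ₀] at h2
    linarith
  have := le_of_continuous_of_dense hsd (by fun_prop) hbound ⟨θ₀, hmem⟩
  simpa using this

end IIDDerivs

end Mean

/-! ### Events of small probability and second moments -/

section Unlikely

variable {Ω : Type*} [MeasurableSpace Ω]

/-- The probability of the event `S A N` is as small as desired for `A` large and then `N` large.
For `S A N = {A * r N < |X N|}` this says that `X N = O_p(r N)`. -/
def EventuallyUnlikely (μ : Measure Ω) (S : ℝ → ℕ → Set Ω) : Prop :=
  ∀ p : ENNReal, 0 < p → ∃ A₀ : ℝ, ∀ A ≥ A₀, ∀ᶠ N in atTop, μ (S A N) ≤ p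

variable {μ : Measure Ω}

theorem EventuallyUnlikely.of_tendsto {S : ℕ → Set Ω} (h : Tendsto (fun N => μ (S N)) atTop (𝓝 0)) :
    EventuallyUnlikely μ fun _ => S :=
  fun _ hp => ⟨0, fun _ _ => h.eventually_le_const hp⟩

theorem EventuallyUnlikely.mono {S T : ℝ → ℕ → Set Ω} (hT : EventuallyUnlikely μ T) {A₁ : ℝ}
    (h : ∀ A ≥ A₁, ∀ᶠ N in atTop, S A N ⊆ T A N) : EventuallyUnlikely μ S := by
  intro p hp
  obtain ⟨A₀, hA₀⟩ := hT p hp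
  refine ⟨max A₀ A₁, fun A hA => ?_⟩
  filter_upwards [hA₀ A (le_of_max_le_left hA), h A (le_of_max_le_right hA)] with N h1 h2
  exact (measure_mono h2).trans h1

theorem EventuallyUnlikely.union {S T : ℝ → ℕ → Set Ω} (hS : EventuallyUnlikely μ S)
    (hT : EventuallyUnlikely μ T) : EventuallyUnlikely μ fun A N => S A N ∪ T A N := by
  intro p hp
  have hp2 : 0 < p / 2 := ENNReal.half_pos hp.ne'
  obtain ⟨A₀, hA₀⟩ := hS _ hp2
  obtain ⟨A₁, hA₁⟩ := hT _ hp2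
  refine ⟨max A₀ A₁, fun A hA => ?_⟩
  filter_upwards [hA₀ A (le_of_max_le_left hA), hA₁ A (le_of_max_le_right hA)] with N h1 h2
  calc μ (S A N ∪ T A N) ≤ p / 2 + p / 2 := (measure_union_le _ _).trans (add_le_add h1 h2)
    _ = p := ENNReal.add_halves p

theorem EventuallyUnlikely.biUnion {ι : Type*} (s : Finset ι) {S : ι → ℝ → ℕ → Set Ω}
    (hS : ∀ i ∈ s, EventuallyUnlikely μ (S i)) :
    EventuallyUnlikely μ fun A N => ⋃ i ∈ s, S i A N := by
  classical
  induction s using Finset.induction_on with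
  | empty => exact fun p _ => ⟨0, fun _ _ => by simp⟩
  | insert i s hi ih =>
    have := (hS i (Finset.mem_insert_self i s)).union
      (ih fun j hj => hS j (Finset.mem_insert_of_mem hj))
    simpa only [Finset.set_biUnion_insert] using this

/-- A bound `V / A ^ 2` on the probabilities suffices. -/
theorem EventuallyUnlikely.of_le_div_sq {S : ℝ → ℕ → Set Ω} {V : ℝ}
    (h : ∀ A > 0, ∀ᶠ N in atTop, μ (S A N) ≤ ENNReal.ofReal (V / A ^ 2)) :
    EventuallyUnlikely μ S := by
  intro p hp
  have hlim : Tendsto (fun A : ℝ => ENNReal.ofReal (V / A ^ 2)) atTop (𝓝 0) := by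
    have h1 : Tendsto (fun A : ℝ => V / A ^ 2) atTop (𝓝 0) :=
      tendsto_const_nhds.div_atTop (tendsto_pow_atTop two_ne_zero)
    simpa using ENNReal.tendsto_ofReal h1
  obtain ⟨A₀, hA₀⟩ := eventually_atTop.1
    ((hlim.eventually_le_const hp).and (eventually_gt_atTop 0))
  exact ⟨A₀, fun A hA => (h A (hA₀ A hA).2).mono fun N hN => hN.trans (hA₀ A hA).1⟩

/-- A single random variable exceeds `N` with vanishing probability. -/
theorem tendsto_measure_natCast_lt [IsFiniteMeasure μ] {f : Ω → ℝ} (hf : AEMeasurable f μ) :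
    Tendsto (fun N : ℕ => μ {ω | (N : ℝ) < f ω}) atTop (𝓝 0) := by
  have h := tendsto_measure_iInter_atTop (μ := μ) (s := fun N : ℕ => {ω | (N : ℝ) < f ω})
    (fun N => hf.nullMeasurableSet_preimage measurableSet_Ioi)
    (fun m n hmn ω (hω : (n : ℝ) < f ω) => show (m : ℝ) < f ω from
      lt_of_le_of_lt (by exact_mod_cast hmn) hω) ⟨0, measure_ne_top _ _⟩
  have hempty : ⋂ N : ℕ, {ω | (N : ℝ) < f ω} = ∅ := by
    refine Set.eq_empty_of_forall_notMem fun ω hω => ?_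
    obtain ⟨N, hN⟩ := exists_nat_ge (f ω)
    have : (N : ℝ) < f ω := Set.mem_iInter.1 hω N
    linarith
  rw [hempty, measure_empty] at h
  exact h

/-- Markov's inequality with squares. -/
theorem measure_lt_le_ofReal_div_sq [IsFiniteMeasure μ] {f : Ω → ℝ}
    (hf : Integrable (fun ω => f ω ^ 2) μ) {a : ℝ} (ha : 0 < a) :
    μ {ω | a < f ω} ≤ ENNReal.ofReal ((∫ ω, f ω ^ 2 ∂μ) / a ^ 2) := by
  have h := mul_meas_ge_le_integral_of_nonneg (μ := μ) (Eventually.of_forall fun ω => sq_nonneg _)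
    hf (a ^ 2)
  have h1 : μ.real {ω | a ^ 2 ≤ f ω ^ 2} ≤ (∫ ω, f ω ^ 2 ∂μ) / a ^ 2 := by
    rw [le_div_iff₀ (by positivity), mul_comm]; exact h
  calc μ {ω | a < f ω} ≤ μ {ω | a ^ 2 ≤ f ω ^ 2} := by
        refine measure_mono fun ω (hω : a < f ω) => show a ^ 2 ≤ f ω ^ 2 from ?_
        gcongr
    _ = ENNReal.ofReal (μ.real {ω | a ^ 2 ≤ f ω ^ 2}) := by
        rw [ofReal_measureReal]
    _ ≤ _ := ENNReal.ofReal_le_ofReal h1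

/-- Independent centred random vectors are orthogonal, so that the second moment of their sum is
the sum of the second moments. -/
theorem integral_norm_sq_sum [IsProbabilityMeasure μ] {D : ℕ} {Z : ℕ → Ω → Param D}
    (hZ : ∀ n, MemLp (Z n) 2 μ) (hind : iIndepFun Z μ)
    (hid : ∀ n, IdentDistrib (Z n) (Z 0) μ μ) (hmean : ∫ ω, Z 0 ω ∂μ = 0) (N : ℕ) :
    Integrable (fun ω => ‖∑ i ∈ Finset.range N, Z i ω‖ ^ 2) μ ∧
    ∫ ω, ‖∑ i ∈ Finset.range N, Z i ω‖ ^ 2 ∂μ = N * ∫ ω, ‖Z 0 ω‖ ^ 2 ∂μ := by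
  have hS : MemLp (fun ω => ∑ i ∈ Finset.range N, Z i ω) 2 μ := memLp_finsetSum _ fun i _ => hZ i
  refine ⟨(memLp_two_iff_integrable_sq_norm hS.1).1 hS, ?_⟩
  have hproj : ∀ d, Measurable fun z : Param D => z d := fun d =>
    (EuclideanSpace.proj (𝕜 := ℝ) d).continuous.measurable
  have hcoord : ∀ {Y : Ω → Param D}, MemLp Y 2 μ → ∀ d, MemLp (fun ω => Y ω d) 2 μ :=
    fun hY d => (EuclideanSpace.proj (𝕜 := ℝ) d).comp_memLp' hY
  have hnorm : ∀ {Y : Ω → Param D}, MemLp Y 2 μ →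
      ∫ ω, ‖Y ω‖ ^ 2 ∂μ = ∑ d, ∫ ω, (Y ω d) ^ 2 ∂μ := by
    intro Y hY
    rw [← integral_finsetSum _ fun d _ => (hcoord hY d).integrable_sq]
    refine integral_congr_ae (Eventually.of_forall fun ω => ?_)
    simp [EuclideanSpace.norm_sq_eq]
  have hmean' : ∀ n d, ∫ ω, Z n ω d ∂μ = 0 := by
    intro n d
    have h1 := (EuclideanSpace.proj (𝕜 := ℝ) d).integral_comp_comm
      ((hZ n).integrable (by norm_num))
    have h2 : ∫ ω, Z n ω ∂μ = 0 := by rw [(hid n).integral_eq, hmean]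
    rw [h2] at h1
    simpa using h1
  rw [hnorm hS, hnorm (hZ 0), Finset.mul_sum]
  refine Finset.sum_congr rfl fun d _ => ?_
  have hvar := IndepFun.variance_sum (μ := μ) (X := fun i ω => Z i ω d) (s := Finset.range N)
    (fun i _ => hcoord (hZ i) d)
    (fun i _ j _ hij => (hind.indepFun hij).comp (hproj d) (hproj d))
  have hv : ∀ i, variance (fun ω => Z i ω d) μ = ∫ ω, (Z 0 ω d) ^ 2 ∂μ := by
    intro i
    rw [variance_of_integral_eq_zero (hcoord (hZ i) d).aemeasurable (hmean' i d)]
    exact ((hid i).comp ((hproj d).pow_const 2)).integral_eq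
  have hmS : ∫ ω, (∑ i ∈ Finset.range N, fun ω => Z i ω d) ω ∂μ = 0 := by
    simp only [Finset.sum_apply]
    rw [integral_finsetSum _ fun i _ => (hcoord (hZ i) d).integrable (by norm_num)]
    simp [hmean']
  rw [variance_of_integral_eq_zero
    (memLp_finsetSum' _ fun i _ => hcoord (hZ i) d).aemeasurable hmS] at hvar
  simp only [hv, Finset.sum_const, Finset.card_range, nsmul_eq_mul, Finset.sum_apply] at hvar
  rw [← hvar]
  simp

end Unlikely

/-! ### Stochastic bounds on the data functions -/

section RandomSample

variable {D K : ℕ} {Ω : Type*} [MeasurableSpace Ω] {μ : Measure Ω} {Ωθ : Set (Param D)}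
  {g : ℕ → Ω → Param D → Param D}

/-- The central limit rate at a root of the mean, by Chebyshev's inequality. -/
theorem IIDDerivs.eventuallyUnlikely_root [IsProbabilityMeasure μ] (h : IIDDerivs μ K Ωθ g)
    {θ₀ : Param D} (hθ : θ₀ ∈ Ωθ) (hg0 : AEMeasurable (fun ω => g 0 ω θ₀) μ)
    (hmean : ∫ ω, g 1 ω θ₀ ∂μ = 0) :
    EventuallyUnlikely μ fun A N =>
      {ω | A * (√N)⁻¹ < ‖estEq N (fun n => g n ω) θ₀ (ones N)‖} := by
  set V := ∫ ω, ‖g 1 ω θ₀‖ ^ 2 ∂μ with hV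
  have h1 : EventuallyUnlikely μ fun _ N => {ω | (N : ℝ) < ‖g 0 ω θ₀‖ ^ 2} :=
    .of_tendsto (tendsto_measure_natCast_lt (hg0.norm.pow_const 2))
  have h2 : EventuallyUnlikely μ fun A N =>
      {ω | A / 2 * √N < ‖∑ i ∈ Finset.range N, g (i + 1) ω θ₀‖} := by
    refine .of_le_div_sq (V := 4 * V) fun A hA => ?_
    filter_upwards [eventually_ge_atTop 1] with N hN
    have hN' : (0 : ℝ) < N := by exact_mod_cast hN
    obtain ⟨hi, he⟩ := integral_norm_sq_sum (μ := μ) (Z := fun n ω => g (n + 1) ω θ₀)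
      (fun n => h.memLp_apply hθ n) (h.iIndepFun_apply hθ)
      (fun n => h.identDistrib_apply hθ n) hmean N
    refine (measure_lt_le_ofReal_div_sq hi (a := A / 2 * √N) (by positivity)).trans (le_of_eq ?_)
    rw [he, mul_pow, Real.sq_sqrt hN'.le]
    congr 1
    simp only [zero_add, ← hV]
    field_simp
    norm_num
  refine (h1.union h2).mono (A₁ := 2) fun A hA => ?_
  filter_upwards [eventually_ge_atTop 1] with N hN
  have hN' : (0 : ℝ) < N := by exact_mod_cast hN
  have hsq : √(N : ℝ) * √N = N := Real.mul_self_sqrt hN'.le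
  have hs : 0 < √(N : ℝ) := Real.sqrt_pos.2 hN'
  intro ω hω
  have hω' : A * (√N)⁻¹ < ‖estEq N (fun n => g n ω) θ₀ (ones N)‖ := hω
  by_contra hcon
  simp only [Set.mem_union, not_or] at hcon
  have c1 : ‖g 0 ω θ₀‖ ^ 2 ≤ N := not_lt.1 hcon.1
  have c2 : ‖∑ i ∈ Finset.range N, g (i + 1) ω θ₀‖ ≤ A / 2 * √N := not_lt.1 hcon.2
  have c3 : ‖g 0 ω θ₀‖ ≤ A / 2 * √N := by
    have : ‖g 0 ω θ₀‖ ≤ √N := Real.le_sqrt_of_sq_le c1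
    nlinarith
  refine absurd hω' (not_lt.2 ?_)
  rw [estEq_ones, norm_smul, norm_inv, Real.norm_natCast]
  calc (N : ℝ)⁻¹ * ‖g 0 ω θ₀ + ∑ i ∈ Finset.range N, g (i + 1) ω θ₀‖
      ≤ (N : ℝ)⁻¹ * (A / 2 * √N + A / 2 * √N) := by
        gcongr
        exact (norm_add_le _ _).trans (add_le_add c3 c2)
    _ = A * (√N)⁻¹ := by
        have hinv : (N : ℝ)⁻¹ = (√(N : ℝ))⁻¹ * (√(N : ℝ))⁻¹ := by rw [← mul_inv, hsq]
        rw [hinv]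
        field_simp
        ring

/-- At a fixed point the maximum of the derivatives of the data functions is `O_p(√N)`, by
Markov's inequality for the second moments. -/
theorem IIDDerivs.eventuallyUnlikely_exists_lt_arrayNorm [IsProbabilityMeasure μ]
    (h : IIDDerivs μ K Ωθ g) {θ₀ : Param D} (hθ : θ₀ ∈ Ωθ) {k : ℕ} (hk : k ≤ K + 1) :
    EventuallyUnlikely μ fun A N =>
      {ω | ∃ n < N, A * √N < arrayNorm (derivArray k (g (n + 1) ω) θ₀)} := by
  set V := ∫ ω, arrayNorm (derivArray k (g 1 ω) θ₀) ^ 2 ∂μ with hV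
  have hVn : ∀ n, ∫ ω, arrayNorm (derivArray k (g (n + 1) ω) θ₀) ^ 2 ∂μ = V := by
    intro n
    have hm : Measurable fun y : Ωθ → DerivArray D k => arrayNorm (y ⟨θ₀, hθ⟩) ^ 2 :=
      (measurable_arrayNorm.comp (measurable_pi_apply (⟨θ₀, hθ⟩ : Ωθ))).pow_const 2
    exact ((h.identDistrib k hk n).comp hm).integral_eq
  refine .of_le_div_sq (V := V) fun A hA => ?_
  filter_upwards [eventually_ge_atTop 1] with N hN
  have hN' : (0 : ℝ) < N := by exact_mod_cast hN
  have hset : {ω | ∃ n < N, A * √N < arrayNorm (derivArray k (g (n + 1) ω) θ₀)} =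
      ⋃ n ∈ Finset.range N, {ω | A * √N < arrayNorm (derivArray k (g (n + 1) ω) θ₀)} := by
    ext ω; simp
  rw [hset]
  calc _ ≤ ∑ n ∈ Finset.range N, μ {ω | A * √N < arrayNorm (derivArray k (g (n + 1) ω) θ₀)} :=
        measure_biUnion_finset_le _ _
    _ ≤ ∑ _n ∈ Finset.range N, ENNReal.ofReal (V / (A * √N) ^ 2) := by
        refine Finset.sum_le_sum fun n _ => ?_
        rw [← hVn n]
        exact measure_lt_le_ofReal_div_sq (h.secondMoment k hk n θ₀ hθ) (by positivity)
    _ = ENNReal.ofReal (N * (V / (A * √N) ^ 2)) := by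
        rw [ENNReal.ofReal_mul hN'.le]; simp
    _ = ENNReal.ofReal (V / A ^ 2) := by
        congr 1
        rw [mul_pow, Real.sq_sqrt hN'.le]
        field_simp

/-- The deterministic assumptions fail for the sample size `N` with vanishing probability. -/
theorem tendsto_measure_not_looAssumptions [IsFiniteMeasure μ]
    {θhat : (N : ℕ) → Ω → Weight N → Param D} {ε C : ℝ} {M : ℕ → ℝ} {N₀ : Ω → ℕ}
    (hN₀ : Measurable N₀)
    (hassu : ∀ᵐ ω ∂μ, ∀ N, N₀ ω ≤ N →
      LooAssumptions K N Ωθ ε C M (fun n => g n ω) (θhat N ω)) :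
    Tendsto (fun N => μ {ω | ¬ LooAssumptions K N Ωθ ε C M (fun n => g n ω) (θhat N ω)}) atTop
      (𝓝 0) := by
  have hf : Measurable fun ω => (N₀ ω : ℝ) := measurable_from_nat.comp hN₀
  refine tendsto_of_tendsto_of_tendsto_of_le_of_le tendsto_const_nhds
    (tendsto_measure_natCast_lt (μ := μ) hf.aemeasurable) (fun _ => zero_le) fun N => ?_
  refine measure_mono_ae ?_
  filter_upwards [hassu] with ω hω hn
  by_contra hcon
  exact hn (hω N (by exact_mod_cast not_lt.1 hcon))

/-- A datum is the difference of two consecutive sums, so that its derivatives grow at most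
linearly in its index, uniformly on the parameter domain. -/
theorem LooAssumptions.norm_iteratedFDeriv_datum_le {n : ℕ} {ε C : ℝ} {M : ℕ → ℝ}
    {f : ℕ → Param D → Param D} {θhat : Weight n → Param D} {θhat' : Weight (n + 1) → Param D}
    (hn : 1 ≤ n) (hΩ : IsOpen Ωθ) (h : LooAssumptions K n Ωθ ε C M f θhat)
    (h' : LooAssumptions K (n + 1) Ωθ ε C M f θhat') {k : ℕ} (h1 : 1 ≤ k) (hk : k ≤ K + 1)
    {θ : Param D} (hθ : θ ∈ Ωθ) :
    ‖iteratedFDeriv ℝ k (f (n + 1)) θ‖ ≤ (3 * (Fintype.card (Fin k → Fin D) * |M k|)) * n := by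
  set B : ℝ := Fintype.card (Fin k → Fin D) * |M k| with hB
  have hB0 : 0 ≤ B := by positivity
  have hn' : (0 : ℝ) < n := by exact_mod_cast hn
  have hkK : ((k : ℕ) : WithTop ℕ∞) ≤ ((K + 1 : ℕ) : WithTop ℕ∞) := by exact_mod_cast hk
  have hf : f (n + 1) = fun θ => ((n + 1 : ℕ) : ℝ) • estEq (n + 1) f θ (ones (n + 1)) -
      (n : ℝ) • estEq n f θ (ones n) := by
    funext θ
    rw [estEq_ones, estEq_ones, smul_inv_smul₀ (by positivity), smul_inv_smul₀ (by positivity),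
      Finset.sum_range_succ]
    abel
  have c1 := (h.contDiffAt_estEq hΩ hθ (ones n)).of_le hkK
  have c2 := (h'.contDiffAt_estEq hΩ hθ (ones (n + 1))).of_le hkK
  rw [hf, fun_iteratedFDeriv_sub_apply (ContDiffAt.const_smul _ c2) (ContDiffAt.const_smul _ c1),
    iteratedFDeriv_const_smul_apply' c1, iteratedFDeriv_const_smul_apply' c2]
  refine (_root_.norm_sub_le _ _).trans ?_
  rw [norm_smul, norm_smul, Real.norm_natCast, Real.norm_natCast]
  have b1 := h.norm_iteratedFDeriv_estEq_le h1 hk hθ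
  have b2 := h'.norm_iteratedFDeriv_estEq_le h1 hk hθ
  have hn1 : (1 : ℝ) ≤ n := by exact_mod_cast hn
  calc _ ≤ ((n + 1 : ℕ) : ℝ) * B + n * B := by gcongr
    _ ≤ _ := by push_cast; nlinarith

/-- The supremum of the norms of a family of arrays over an index set; for a countable set it is
measurable, and for a dense one it is the supremum over the domain if the family is continuous. -/
noncomputable def supArrayNorm {k : ℕ} (s : Set Ωθ) (y : Ωθ → DerivArray D k) : ENNReal :=
  ⨆ q ∈ s, ENNReal.ofReal (arrayNorm (y q))

theorem measurable_supArrayNorm {k : ℕ} {s : Set Ωθ} (hs : s.Countable) :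
    Measurable (supArrayNorm s : (Ωθ → DerivArray D k) → ENNReal) :=
  Measurable.biSup s hs fun q _ =>
    (measurable_arrayNorm.comp (measurable_pi_apply q)).ennreal_ofReal

theorem norm_iteratedFDeriv_le_of_supArrayNorm_le {k : ℕ} {s : Set Ωθ} (hs : Dense s)
    {f : Param D → Param D} (hf : ∀ θ ∈ Ωθ, ContDiffAt ℝ k f θ) {r : ℝ} (hr : 0 ≤ r)
    (h : supArrayNorm s (fun θ : Ωθ => derivArray k f θ) ≤ ENNReal.ofReal r)
    {θ : Param D} (hθ : θ ∈ Ωθ) :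
    ‖iteratedFDeriv ℝ k f θ‖ ≤ (Fintype.card (Fin k → Fin D) : ℝ) * r := by
  set B : ℝ := (Fintype.card (Fin k → Fin D) : ℝ) * r with hB
  have hdense : ∀ q ∈ s, ‖iteratedFDeriv ℝ k f q‖ ≤ B := by
    intro q hq
    have h2 : ENNReal.ofReal (arrayNorm (derivArray k f q)) ≤ ENNReal.ofReal r :=
      (iSup₂_le_iff.1 h) q hq
    rw [ENNReal.ofReal_le_ofReal_iff hr] at h2
    exact (norm_iteratedFDeriv_le_arrayNorm k f q).trans
      (mul_le_mul_of_nonneg_left h2 (Nat.cast_nonneg _))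
  have hcont : Continuous fun q : Ωθ => ‖iteratedFDeriv ℝ k f q‖ := by
    refine continuous_iff_continuousAt.2 fun q => ContinuousAt.norm ?_
    have h3 : ContDiffAt ℝ 0 (iteratedFDeriv ℝ k f) (q : Param D) :=
      (hf q q.2).iteratedFDeriv_right (m := 0) (i := k) (by rw [zero_add])
    exact ContinuousAt.comp (g := iteratedFDeriv ℝ k f) h3.continuousAt
      continuous_subtype_val.continuousAt
  exact le_of_continuous_of_dense hs hcont hdense ⟨θ, hθ⟩

/-- Uniformly on the parameter domain, the derivatives of the data functions are `o(N)` in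
probability. No moment of their suprema is assumed: a first moment is a consequence of the uniform
bounds on the estimating functions. -/
theorem IIDDerivs.tendsto_measure_exists_lt_norm_iteratedFDeriv [IsProbabilityMeasure μ]
    (h : IIDDerivs μ K Ωθ g) (hΩ : IsOpen Ωθ)
    {θhat : (N : ℕ) → Ω → Weight N → Param D} {ε C : ℝ} {M : ℕ → ℝ} {N₀ : Ω → ℕ}
    (hN₀ : Measurable N₀)
    (hassu : ∀ᵐ ω ∂μ, ∀ N, N₀ ω ≤ N →
      LooAssumptions K N Ωθ ε C M (fun n => g n ω) (θhat N ω))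
    {k : ℕ} (h1 : 1 ≤ k) (hk : k ≤ K + 1) {c : ℝ} (hc : 0 < c) :
    Tendsto (fun N : ℕ => μ {ω | ∃ n < N, ∃ θ ∈ Ωθ, c * N < ‖iteratedFDeriv ℝ k (g (n + 1) ω) θ‖})
      atTop (𝓝 0) := by
  obtain ⟨s, hsc, hsd⟩ := TopologicalSpace.exists_countable_dense Ωθ
  have hφm := measurable_supArrayNorm (k := k) hsc
  set X : ℕ → Ω → ENNReal := fun n ω =>
    supArrayNorm s fun θ : Ωθ => derivArray k (g (n + 1) ω) θ with hX
  have hind : iIndepFun X μ := (h.indep k hk).comp (fun _ => supArrayNorm s) fun _ => hφm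
  have hid : ∀ n, IdentDistrib (X n) (X 0) μ μ := fun n => (h.identDistrib k hk n).comp hφm
  set m : ℝ := (Fintype.card (Fin k → Fin D) : ℝ) with hm
  set b : ℝ := m * D * (3 * (m * |M k|)) + 1 with hb
  have hb0 : 0 < b := by positivity
  have hbd : ∀ᵐ ω ∂μ, ∀ᶠ n : ℕ in atTop, X n ω ≤ ENNReal.ofReal (b * n) := by
    filter_upwards [hassu] with ω hω
    filter_upwards [eventually_ge_atTop (N₀ ω), eventually_ge_atTop 1] with n hn hn1
    refine iSup₂_le fun q _ => ENNReal.ofReal_le_ofReal ?_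
    have := (hω n hn).norm_iteratedFDeriv_datum_le hn1 hΩ (hω (n + 1) (by omega)) h1 hk q.2
    calc arrayNorm (derivArray k (g (n + 1) ω) q)
        ≤ m * D * ‖iteratedFDeriv ℝ k (g (n + 1) ω) q‖ := arrayNorm_le_norm_iteratedFDeriv _ _ _
      _ ≤ m * D * ((3 * (m * |M k|)) * n) := by gcongr
      _ ≤ b * n := by
        rw [hb, ← mul_assoc, add_mul]
        have : (0 : ℝ) ≤ 1 * n := by positivity
        linarith
  have he0 : 0 < m + 1 := by positivity
  have hlim := (tendsto_measure_not_looAssumptions hN₀ hassu).add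
    (tendsto_measure_exists_lt_of_ae_eventually_le hind hid hb0 (div_pos hc he0) hbd)
  rw [add_zero] at hlim
  refine tendsto_of_tendsto_of_tendsto_of_le_of_le tendsto_const_nhds hlim
    (fun _ => zero_le) fun N => ?_
  refine (measure_mono ?_).trans (measure_union_le _ _)
  rintro ω ⟨n, hn, θ, hθ, hlt⟩
  by_contra hcon
  simp only [Set.mem_union, not_or] at hcon
  have hloo : LooAssumptions K N Ωθ ε C M (fun n => g n ω) (θhat N ω) := not_not.1 hcon.1
  have hle : X n ω ≤ ENNReal.ofReal (c / (m + 1) * N) :=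
    not_lt.1 fun hlt => hcon.2 ⟨n, hn, hlt⟩
  have hfin := norm_iteratedFDeriv_le_of_supArrayNorm_le (f := g (n + 1) ω) hsd
    (fun θ hθ => (hloo.contDiffAt hΩ (by omega : n + 1 ≤ N) hθ).of_le (by exact_mod_cast hk))
    (by positivity) hle hθ
  refine absurd hlt (not_lt.2 (hfin.trans ?_))
  calc m * (c / (m + 1) * N) ≤ (m + 1) * (c / (m + 1) * N) := by gcongr; linarith
    _ = c * N := by field_simp

end RandomSample

/-! ### The expansion with high probability -/

section Conclusion

variable {D K : ℕ} {Ω : Type*} [MeasurableSpace Ω] {μ : Measure Ω} {Ωθ : Set (Param D)}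
  {g : ℕ → Ω → Param D → Param D}

theorem inv_sqrt_pow_eq_rpow (N K : ℕ) :
    ((√(N : ℝ))⁻¹) ^ (K + 1) = (N : ℝ) ^ (-((K : ℝ) + 1) / 2) := by
  have hN : (0 : ℝ) ≤ N := by positivity
  rw [Real.sqrt_eq_rpow, ← Real.rpow_neg hN, ← Real.rpow_natCast, ← Real.rpow_mul hN]
  congr 1
  push_cast
  ring

/-- Off an unlikely event the solution is smooth at `1_N` and the expansion holds with a constant
that depends neither on the sample nor on its size. -/
theorem exists_eventuallyUnlikely_hoijError_le [IsProbabilityMeasure μ]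
    (hΩ : IsOpen Ωθ) (hΩc : Convex ℝ Ωθ)
    (hg0 : ∀ θ ∈ Ωθ, AEMeasurable (fun ω => g 0 ω θ) μ) (hiid : IIDDerivs μ K Ωθ g)
    {θhat : (N : ℕ) → Ω → Weight N → Param D} {ε C : ℝ} (hε : 0 < ε) {M : ℕ → ℝ} {N₀ : Ω → ℕ}
    (hN₀ : Measurable N₀)
    (hassu : ∀ᵐ ω ∂μ, ∀ N, N₀ ω ≤ N →
      LooAssumptions K N Ωθ ε C M (fun n => g n ω) (θhat N ω)) :
    ∃ S : ℝ → ℕ → Set Ω, EventuallyUnlikely μ S ∧ ∀ A ≥ 1, ∃ R : ℝ, ∀ N ≥ 1, ∀ ω ∉ S A N,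
      ContDiffAt ℝ (K : WithTop ℕ∞) (θhat N ω) (ones N) ∧
      ∀ n : Fin N, hoijError K (θhat N ω) (looWeight n) ≤
        R * (N : ℝ) ^ (-((K : ℝ) + 1) / 2) := by
  obtain ⟨θ₀, hθ₀, hmean⟩ := hiid.exists_root hΩ hΩc hε hassu
  have hC : 0 ≤ C := by
    obtain ⟨ω, hω⟩ := hassu.exists
    exact (hω (N₀ ω) le_rfl).nonneg hθ₀
  set c : ℝ := 1 / (2 * (C + 1)) with hc
  have hc0 : 0 < c := by positivity
  have hCc : C * c ≤ 1 / 2 := by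
    rw [hc, mul_one_div, div_le_div_iff₀ (by positivity) (by positivity)]
    linarith
  have hc1 : c ≤ 1 := by
    rw [hc, div_le_one (by positivity)]
    linarith
  set e : ℕ → ℝ := fun k => (Fintype.card (Fin k → Fin D) : ℝ) with he
  have he0 : ∀ k, 0 ≤ e k := fun k => Nat.cast_nonneg _
  set S₁ : ℝ → ℕ → Set Ω := fun _ N =>
    {ω | ¬ LooAssumptions K N Ωθ ε C M (fun n => g n ω) (θhat N ω)} with hS₁
  set S₂ : ℝ → ℕ → Set Ω := fun A N =>
    {ω | A * (√N)⁻¹ < ‖estEq N (fun n => g n ω) θ₀ (ones N)‖} with hS₂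
  set S₃ : ℝ → ℕ → Set Ω := fun A N => ⋃ k ∈ Finset.range (K + 1),
    {ω | ∃ n < N, A * √N < arrayNorm (derivArray k (g (n + 1) ω) θ₀)} with hS₃
  set S₄ : ℝ → ℕ → Set Ω := fun _ N => ⋃ k ∈ Finset.Icc 1 (K + 1),
    {ω | ∃ n < N, ∃ θ ∈ Ωθ, c * N < ‖iteratedFDeriv ℝ k (g (n + 1) ω) θ‖} with hS₄
  have h1 : EventuallyUnlikely μ S₁ := .of_tendsto (tendsto_measure_not_looAssumptions hN₀ hassu)
  have h2 : EventuallyUnlikely μ S₂ := hiid.eventuallyUnlikely_root hθ₀ (hg0 θ₀ hθ₀) hmean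
  have h3 : EventuallyUnlikely μ S₃ := .biUnion _ fun k hk =>
    hiid.eventuallyUnlikely_exists_lt_arrayNorm hθ₀ (Finset.mem_range.1 hk).le
  have h4 : EventuallyUnlikely μ S₄ := .biUnion _ fun k hk => .of_tendsto <|
    hiid.tendsto_measure_exists_lt_norm_iteratedFDeriv hΩ hN₀ hassu (Finset.mem_Icc.1 hk).1
      (Finset.mem_Icc.1 hk).2 hc0
  refine ⟨_, ((h1.union h2).union h3).union h4, fun A hA => ?_⟩
  -- one constant that dominates all bounds of the deterministic expansion
  set B : ℝ := A * (1 + ∑ k ∈ Finset.range (K + 2), e k) +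
    ∑ k ∈ Finset.range (K + 2), e k * |M k| with hB
  have hse : 0 ≤ ∑ k ∈ Finset.range (K + 2), e k := Finset.sum_nonneg fun k _ => he0 k
  have hsM : 0 ≤ ∑ k ∈ Finset.range (K + 2), e k * |M k| :=
    Finset.sum_nonneg fun k _ => mul_nonneg (he0 k) (abs_nonneg _)
  have hA0 : 0 ≤ A := by linarith
  have hAe : A ≤ A * (1 + ∑ k ∈ Finset.range (K + 2), e k) :=
    le_mul_of_one_le_right hA0 (by linarith)
  have hAB : A ≤ B := by linarith
  have heB : ∀ k ≤ K + 1, e k * A ≤ B := by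
    intro k hk
    have : e k ≤ ∑ k ∈ Finset.range (K + 2), e k :=
      Finset.single_le_sum (fun k _ => he0 k) (Finset.mem_range.2 (by omega))
    nlinarith
  have hMB : ∀ k ≤ K + 1, e k * |M k| ≤ B := by
    intro k hk
    have : e k * |M k| ≤ ∑ k ∈ Finset.range (K + 2), e k * |M k| :=
      Finset.single_le_sum (f := fun k => e k * |M k|)
        (fun k _ => mul_nonneg (he0 k) (abs_nonneg _)) (Finset.mem_range.2 (by omega))
    linarith
  obtain ⟨R, hR⟩ := exists_hoijError_le K hΩ hΩc hε C B c hC hCc hc0.le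
    (by linarith)
  refine ⟨R, fun N hN ω hω => ?_⟩
  simp only [Set.mem_union, not_or] at hω
  obtain ⟨⟨⟨hω1, hω2⟩, hω3⟩, hω4⟩ := hω
  have hloo : LooAssumptions K N Ωθ ε C M (fun n => g n ω) (θhat N ω) := not_not.1 hω1
  have hroot : ‖estEq N (fun n => g n ω) θ₀ (ones N)‖ ≤ A * (√N)⁻¹ := not_lt.1 hω2
  have hpoint : ∀ k ≤ K, ∀ n < N, arrayNorm (derivArray k (g (n + 1) ω) θ₀) ≤ A * √N := by
    intro k hk n hn
    by_contra hcon
    exact hω3 (Set.mem_biUnion (Finset.mem_coe.2 (Finset.mem_range.2 (by omega)))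
      ⟨n, hn, not_le.1 hcon⟩)
  have hunif : ∀ k, 1 ≤ k → k ≤ K + 1 → ∀ n < N, ∀ θ ∈ Ωθ,
      ‖iteratedFDeriv ℝ k (g (n + 1) ω) θ‖ ≤ c * N := by
    intro k hk1 hk n hn θ hθ
    by_contra hcon
    exact hω4 (Set.mem_biUnion (Finset.mem_coe.2 (Finset.mem_Icc.2 ⟨hk1, hk⟩))
      ⟨n, hn, θ, hθ, not_le.1 hcon⟩)
  have hN' : (1 : ℝ) ≤ N := by exact_mod_cast hN
  have hs1 : 1 ≤ √(N : ℝ) := Real.one_le_sqrt.2 hN'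
  have hsN : (√(N : ℝ))⁻¹ * N = √N := by
    nth_rewrite 2 [← Real.mul_self_sqrt (Nat.cast_nonneg N)]
    rw [inv_mul_cancel_left₀ (by positivity)]
  have hgood : GoodSample K N Ωθ B c (√N)⁻¹ θ₀ fun n => g n ω :=
    { mem := hθ₀
      root := hroot.trans (by gcongr)
      deriv_root := fun n k hk => by
        rw [mul_assoc, hsN]
        calc _ ≤ e k * arrayNorm (derivArray k (g (n + 1) ω) θ₀) :=
              norm_iteratedFDeriv_le_arrayNorm k _ _
          _ ≤ e k * (A * √N) := mul_le_mul_of_nonneg_left (hpoint k hk n n.2) (he0 k)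
          _ = e k * A * √N := by ring
          _ ≤ B * √N := by gcongr; exact heB k (by omega)
      deriv_le := fun n k hk1 hk θ hθ => hunif k hk1 hk n n.2 θ hθ }
  have := hR N (√N)⁻¹ M (fun n => g n ω) (θhat N ω) θ₀ hN (by positivity)
    (inv_le_one_of_one_le₀ hs1) hloo hgood
    (fun k hk1 hk θ hθ => (hloo.norm_iteratedFDeriv_estEq_le hk1 hk hθ).trans (hMB k hk))
  rwa [inv_sqrt_pow_eq_rpow] at this

end Conclusion

end HOIJ

theorem mainTheorem6 {Ω : Type*} [MeasurableSpace Ω] (μ : Measure Ω) [IsProbabilityMeasure μ]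
    (D K : ℕ)
    -- the parameter domain
    (Ωθ : Set (HOIJ.Param D)) (hΩopen : IsOpen Ωθ) (hΩconvex : Convex ℝ Ωθ)
    -- the random functions `g_0` (regularization) and `g_1, g_2, …` (data)
    (g : ℕ → Ω → HOIJ.Param D → HOIJ.Param D)
    (hg0 : ∀ θ ∈ Ωθ, AEMeasurable (fun ω => g 0 ω θ) μ)
    (hiid : HOIJ.IIDDerivs μ K Ωθ g)
    -- the solution `θhat N ω w` of the estimating equation with weights `w`
    (θhat : (N : ℕ) → Ω → HOIJ.Weight N → HOIJ.Param D)
    -- constants that do not depend on `N`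
    (ε C : ℝ) (hε : 0 < ε) (M : ℕ → ℝ)
    -- the deterministic assumptions hold for all `N`, from some (possibly random) index on
    (N₀ : Ω → ℕ) (hN₀ : Measurable N₀)
    (hassu : ∀ᵐ ω ∂μ, ∀ N, N₀ ω ≤ N →
      HOIJ.LooAssumptions K N Ωθ ε C M (fun n => g n ω) (θhat N ω)) :
    -- the derivatives that define the approximation exist with probability tending to one
    Tendsto (fun N => μ {ω | ¬ ContDiffAt ℝ (K : WithTop ℕ∞) (θhat N ω) (HOIJ.ones N)})
      atTop (𝓝 0) ∧
    HOIJ.IsBigOInProb μ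
      (fun N ω => ⨆ n : Fin N, HOIJ.hoijError K (θhat N ω) (HOIJ.looWeight n))
      (fun N => (N : ℝ) ^ (-((K : ℝ) + 1) / 2)) := by
  obtain ⟨S, hS, hbound⟩ := HOIJ.exists_eventuallyUnlikely_hoijError_le hΩopen hΩconvex hg0 hiid
    hε hN₀ hassu
  constructor
  · rw [ENNReal.tendsto_nhds_zero]
    intro p hp
    obtain ⟨A₀, hA₀⟩ := hS p hp
    obtain ⟨R, hR⟩ := hbound (max A₀ 1) (le_max_right _ _)
    filter_upwards [hA₀ _ (le_max_left A₀ 1), eventually_ge_atTop 1] with N h1 h2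
    refine (measure_mono fun ω hω => ?_).trans h1
    by_contra hcon
    exact hω (hR N h2 ω hcon).1
  · intro p hp
    obtain ⟨A₀, hA₀⟩ := hS p hp
    obtain ⟨R, hR⟩ := hbound (max A₀ 1) (le_max_right _ _)
    refine ⟨R, ?_⟩
    filter_upwards [hA₀ _ (le_max_left A₀ 1), eventually_ge_atTop 1] with N h1 h2
    refine (measure_mono fun ω hω => ?_).trans h1
    by_contra hcon
    have hω' : R * (N : ℝ) ^ (-((K : ℝ) + 1) / 2) <
      |⨆ n : Fin N, HOIJ.hoijError K (θhat N ω) (HOIJ.looWeight n)| := hω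
    refine absurd hω' (not_lt.2 ?_)
    have : Nonempty (Fin N) := ⟨⟨0, h2⟩⟩
    have hpos : 0 ≤ ⨆ n : Fin N, HOIJ.hoijError K (θhat N ω) (HOIJ.looWeight n) :=
      Real.iSup_nonneg fun n => norm_nonneg _
    rw [abs_of_nonneg hpos]
    exact ciSup_le (hR N h2 ω hcon).2
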